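/- Let $\mathbb K=\mathbb R$ or $\mathbb C$. For $p>0$ and a Banach space $X$ over $\mathbb K$ let $\ell_p^w(X)$ be the set of sequences $(x_j)_{j\ge1}$ in $X$ with $(\varphi(x_j))_j\in\ell_p$ for every $\varphi\in X^*$. For Banach spaces $X_1,\dots,X_n,Y$ over $\mathbb K$ and $0<r,q_1,\dots,q_n<\infty$ with $\frac1r\le\frac1{q_1}+\cdots+\frac1{q_n}$, let $\Pi^n_{(r;q_1,\dots,q_n)}(X_1,\dots,X_n;Y)$ be the set of continuous $n$-linear operators $T:X_1\times\cdots\times X_n\to Y$ such that $\sum_{j}\|T(x^{(1)}_j,\dots,x^{(n)}_j)\|^r<\infty$ whenever $(x^{(k)}_j)_j\in\ell^w_{q_k}(X_k)$ for $k=1,\dots,n$. A Banach space $X$ has cotype $s$, where $2\le s<\infty$, if there is a constant $C$ with $\left(\sum_{i=1}^m\|x_i\|^s\right)^{1/s}\le C\left(2^{-m}\sum_{\varepsilon\in\{1,-1\}^m}\left\|\sum_{i=1}^m\varepsilon_ix_i\right\|^2\right)^{1/2}$ for all $m$ and all $x_1,\dots,x_m\in X$. Put $s^*=s/(s-1)$.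 Say that $(s,p,q)$ is in range if either $s>2$ and $1\le p\le q<s^*$, or $s=2$ and $1\le p\le q\le2$. Let $n\ge2$ be an integer and let $(s,p,q)$ be in range. Then for all Banach spaces $X_1,\dots,X_n$ of cotype $s$ and every Banach space $Y$ over $\mathbb K$, $$\Pi^n_{(q;q,\dots,q)}(X_1,\dots,X_n;Y)=\Pi^n_{\left(\frac{qp}{n(q-p)+p};p,\dots,p\right)}(X_1,\dots,X_n;Y).$$ Moreover, let $A_{p,q,n}$ be the set of all $\alpha>0$ with $\frac1\alpha\le\frac np$ such that $$\Pi^n_{(q;q,\dots,q)}(X_1,\dots,X_n;Y)\subseteq\Pi^n_{(\alpha;p,\dots,p)}(X_1,\dots,X_n;Y)$$ for every $\sigma$ with $(\sigma,p,q)$ in range, all Banach spaces $X_1,\dots,X_n$ of cotype $\sigma$ and all Banach spaces $Y$ over $\mathbb K$, and let $\alpha_{p,q,n}=\inf A_{p,q,n}$ be the optimal exponent. Then $\frac{qp}{n(q-p)+p}\in A_{p,q,n}$, and in particular $$\alpha_{p,q,n}\le\frac{qp}{n(q-p)+p}.$$ -/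

import Mathlib

universe u v w

/-- The sequence `x` is weakly `p`-summable, i.e. belongs to `ℓ_p^w(X)`: every continuous linear
functional maps it into `ℓ_p`. -/
def WeaklySummable (𝕜 : Type w) [RCLike 𝕜] {X : Type u} [NormedAddCommGroup X] [NormedSpace 𝕜 X]
    (p : ℝ) (x : ℕ → X) : Prop :=
  ∀ φ : StrongDual 𝕜 X, Memℓp (E := fun _ : ℕ => 𝕜) (fun j => φ (x j)) (ENNReal.ofReal p)

/-- The class `Π^n_{(p; q_1, …, q_n)}(X_1, …, X_n; Y)` of absolutely `(p; q_1, …, q_n)`-summing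
continuous `n`-linear operators. It is meant for positive exponents with
`1 / p ≤ 1 / q_1 + ⋯ + 1 / q_n`. -/
def absolutelySumming (𝕜 : Type w) [RCLike 𝕜] {n : ℕ} (X : Fin n → Type u)
    [∀ i, NormedAddCommGroup (X i)] [∀ i, NormedSpace 𝕜 (X i)]
    (Y : Type v) [NormedAddCommGroup Y] [NormedSpace 𝕜 Y] (p : ℝ) (q : Fin n → ℝ) :
    Set (ContinuousMultilinearMap 𝕜 X Y) :=
  {T | ∀ x : (i : Fin n) → ℕ → X i, (∀ i, WeaklySummable 𝕜 (q i) (x i)) →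
    Memℓp (E := fun _ : ℕ => Y) (fun j => T fun i => x i j) (ENNReal.ofReal p)}

/-- `X` has (finite) cotype `s`, where `2 ≤ s < ∞`. The average over all choices of signs
`ε ∈ {1, -1}^m` is the second moment of the Rademacher sum `∑ ε_i x_i`. -/
def HasCotype (X : Type u) [NormedAddCommGroup X] (s : ℝ) : Prop :=
  2 ≤ s ∧ ∃ C : ℝ, ∀ (m : ℕ) (x : Fin m → X),
    (∑ i, ‖x i‖ ^ s) ^ (1 / s) ≤
      C * √((∑ ε : Fin m → ℤˣ, ‖∑ i, (ε i : ℤ) • x i‖ ^ 2) / 2 ^ m)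

/-- The range of exponents: `1 ≤ p ≤ q < s^*` if `s > 2`, and `1 ≤ p ≤ q ≤ 2` if `s = 2`. -/
def CotypeRange (s p q : ℝ) : Prop :=
  1 ≤ p ∧ p ≤ q ∧ ((2 < s ∧ q < s.conjExponent) ∨ (s = 2 ∧ q ≤ 2))

/-- The exponents `α > 0`, with `1 / α ≤ 1 / p + ⋯ + 1 / p` so that absolutely
`(α; p, …, p)`-summing operators are defined, for which
`Π^n_{(q; q, …, q)}(X_1, …, X_n; Y) ⊆ Π^n_{(α; p, …, p)}(X_1, …, X_n; Y)` for all Banach spaces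
`X_1, …, X_n` of a common cotype `s` in the range belonging to `p, q`, and all Banach
spaces `Y`. -/
def inclusionExponents (𝕜 : Type w) [RCLike 𝕜] (n : ℕ) (p q : ℝ) : Set ℝ :=
  {α | 0 < α ∧ 1 / α ≤ ∑ _i : Fin n, 1 / p ∧
    ∀ s : ℝ, CotypeRange s p q →
    ∀ (X : Fin n → Type u) [∀ i, NormedAddCommGroup (X i)] [∀ i, NormedSpace 𝕜 (X i)]
      [∀ i, CompleteSpace (X i)], (∀ i, HasCotype (X i) s) →
    ∀ (Y : Type v) [NormedAddCommGroup Y] [NormedSpace 𝕜 Y] [CompleteSpace Y],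
      absolutelySumming 𝕜 X Y q (fun _ => q) ⊆ absolutelySumming 𝕜 X Y α (fun _ => p)}

/-- The optimal exponent `α_{p,q,n}`: the infimum of all exponents for which the
inclusion holds. -/
noncomputable def optimalExponent (𝕜 : Type w) [RCLike 𝕜] (n : ℕ) (p q : ℝ) : ℝ :=
  sInf (inclusionExponents.{u, v, w} 𝕜 n p q)

/-! ### Domination by a weight for operators from finite-dimensional sup-normed spaces. -/

section FiniteSup

variable {𝕜 : Type w} [RCLike 𝕜] {X : Type u} [NormedAddCommGroup X] [NormedSpace 𝕜 X]
  {ι : Type*} [Fintype ι]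

/-! Put 1/r = 1/p - 1/q. The core is a factorization (`WeaklySummable.exists_factorization`): in
cotype `s`, a weakly p-summable sequence is x_j = l_j y_j with l in ℓ_r and y weakly q-summable. By
multilinearity T(x_j) = (∏_k l^{(k)}_j) T(y_j); the product lies in ℓ_{r/n} and T(y) in ℓ_q, so
Hölder puts T(x) in ℓ_α with 1/α = n/r + 1/q, which is the stated exponent. The reverse inclusion
needs no cotype: multiplying a weakly q-summable sequence by an ℓ_r sequence gives a weakly
p-summable one, and the converse of Hölder's inequality (`summable_rpow_of_forall_mul`) recovers
T(x) in ℓ_q.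

For the factorization let t = q^*. Cotype makes contractions from a sup-normed space to X
(s,1)-summing, hence dominated by a weight (Pisier). A dyadic argument upgrades this to domination
by an L_t norm when s < t; for s = t = 2 domination in L_4, a fourth-moment Khinchin inequality and
cotype 2 suffice. Either way such operators are t-concave (`SupConcave`). Hahn-Banach separation
turns concavity into a weight w in the unit ball of ℓ_{r/t} with ‖∑ a_j x_j‖^t ≤ D ∑ w_j |a_j|^t,
for x normalized. Then l = w^{1/t} and y = x / l. -/

theorem exists_norm_le_one_mul_eq_norm (z : 𝕜) : ∃ u : 𝕜, ‖u‖ ≤ 1 ∧ u * z = (‖z‖ : 𝕜) := by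
  rcases eq_or_ne z 0 with rfl | hz
  · exact ⟨0, by simp, by simp⟩
  · have hz' : (‖z‖ : 𝕜) ≠ 0 := by simpa using hz
    refine ⟨(starRingEnd 𝕜) z / ‖z‖, ?_, ?_⟩
    · simp [hz]
    · rw [div_mul_eq_mul_div, RCLike.conj_mul, sq, mul_div_assoc, div_self hz', mul_one]

theorem LinearMap.apply_eq_sum_mul_single [DecidableEq ι] (Ξ : (ι → 𝕜) →ₗ[𝕜] 𝕜) (g : ι → 𝕜) :
    Ξ g = ∑ j, g j * Ξ (Pi.single j 1) := by
  conv_lhs => rw [pi_eq_sum_univ' g]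
  simp only [map_sum, map_smul, smul_eq_mul]

theorem LinearMap.norm_apply_le_sum_single [DecidableEq ι] (Ξ : (ι → 𝕜) →ₗ[𝕜] 𝕜) (g : ι → 𝕜) :
    ‖Ξ g‖ ≤ ∑ j, ‖Ξ (Pi.single j 1)‖ * ‖g j‖ := by
  rw [Ξ.apply_eq_sum_mul_single g]
  refine (norm_sum_le _ _).trans (le_of_eq ?_)
  exact Finset.sum_congr rfl fun j _ => by rw [norm_mul, mul_comm]

theorem LinearMap.sum_norm_apply_single_le [DecidableEq ι] (Ξ : (ι → 𝕜) →ₗ[𝕜] 𝕜) {κ : ℝ}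
    (h : ∀ g : ι → 𝕜, (∀ j, ‖g j‖ ≤ 1) → ‖Ξ g‖ ≤ κ) : ∑ j, ‖Ξ (Pi.single j 1)‖ ≤ κ := by
  choose u hu1 hu2 using fun j => exists_norm_le_one_mul_eq_norm (Ξ (Pi.single j 1))
  have := h u hu1
  rw [Ξ.apply_eq_sum_mul_single u] at this
  simp only [hu2] at this
  rw [← RCLike.ofReal_sum, RCLike.norm_ofReal, abs_of_nonneg (by positivity)] at this
  exact this

/-- The tangent line inequality for the convex function `t ↦ t ^ s`. -/
theorem Real.rpow_sub_rpow_le {s κ G : ℝ} (hs : 1 ≤ s) (hκ : 0 < κ) (hG : 0 ≤ G) :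
    κ ^ s - G ^ s ≤ s * κ ^ (s - 1) * (κ - G) := by
  have h := one_add_mul_self_le_rpow_one_add (s := G / κ - 1)
    (by have := div_nonneg hG hκ.le; linarith) hs
  rw [add_sub_cancel, Real.div_rpow hG hκ.le, le_div_iff₀ (by positivity)] at h
  have h2 : κ ^ s = κ ^ (s - 1) * κ := by
    rw [← Real.rpow_add_one hκ.ne', sub_add_cancel]
  have h3 : (1 + s * (G / κ - 1)) * κ ^ s = κ ^ s - s * κ ^ (s - 1) * (κ - G) := by
    rw [h2]; field_simp; ring
  linarith

theorem sum_norm_rpow_sub_one_mul_le {m : ℕ} {s : ℝ} (hs : 1 < s) (a b : Fin m → ℝ)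
    (ha : ∀ i, 0 ≤ a i) (hb : ∀ i, 0 ≤ b i) :
    ∑ i, a i ^ (s - 1) * b i ≤ (∑ i, a i ^ s) ^ ((s - 1) / s) * (∑ i, b i ^ s) ^ (1 / s) := by
  have hc : (s.conjExponent).HolderConjugate s := (Real.HolderConjugate.conjExponent hs).symm
  have h := Real.inner_le_Lp_mul_Lq Finset.univ (fun i => a i ^ (s - 1)) b hc
  have hs' : s - 1 ≠ 0 := by linarith
  have e1 : ∀ i, |a i ^ (s - 1)| ^ s.conjExponent = a i ^ s := fun i => by
    rw [abs_of_nonneg (Real.rpow_nonneg (ha i) _), ← Real.rpow_mul (ha i), Real.conjExponent]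
    congr 1
    field_simp
  have e2 : ∀ i, |b i| = b i := fun i => abs_of_nonneg (hb i)
  simp only [e1, e2] at h
  simpa only [Real.conjExponent, one_div_div] using h

/-- Near-extremal form of Pisier's domination theorem for `(s, 1)`-summing operators on a finite
dimensional sup-normed space. -/
theorem exists_weight_add_of_summing {s K₀ δ : ℝ} (hs : 1 < s) (hδ : 0 < δ)
    (V : (ι → 𝕜) →ₗ[𝕜] X)
    (hV : ∀ (m : ℕ) (f : Fin m → ι → 𝕜), (∀ j, ∑ i, ‖f i j‖ ≤ 1) → ∑ i, ‖V (f i)‖ ^ s ≤ K₀) :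
    ∃ ν : ι → ℝ, (∀ j, 0 ≤ ν j) ∧ ∑ j, ν j ≤ s * K₀ ∧
      ∀ h : ι → 𝕜, (∀ j, ‖h j‖ ≤ 1) → ‖V h‖ ^ s ≤ ∑ j, ν j * ‖h j‖ + δ := by
  classical
  set S : Set ℝ := {y | ∃ (m : ℕ) (f : Fin m → ι → 𝕜), (∀ j, ∑ i, ‖f i j‖ ≤ 1) ∧
    y = ∑ i, ‖V (f i)‖ ^ s} with hS
  have hbdd : BddAbove S := ⟨K₀, by rintro _ ⟨m, f, hf, rfl⟩; exact hV m f hf⟩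
  have hne : S.Nonempty := ⟨_, 0, fun _ _ => 0, by simp, rfl⟩
  set K := sSup S with hK
  have hKK : K ≤ K₀ := csSup_le hne (by rintro _ ⟨m, f, hf, rfl⟩; exact hV m f hf)
  have hmem : ∀ (m : ℕ) (f : Fin m → ι → 𝕜), (∀ j, ∑ i, ‖f i j‖ ≤ 1) →
      ∑ i, ‖V (f i)‖ ^ s ≤ K := fun m f hf => le_csSup hbdd ⟨m, f, hf, rfl⟩
  have hK0 : 0 ≤ K := by simpa using hmem 0 (fun _ _ => 0) (by simp)
  rcases hK0.eq_or_lt with hK0 | hKpos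
  · refine ⟨0, by simp, by simp; nlinarith, fun h hh => ?_⟩
    have := hmem 1 (fun _ => h) (by simpa using hh)
    simp at this ⊢
    linarith
  set κ := K ^ (1 / s) with hκ
  have hκpos : 0 < κ := Real.rpow_pos_of_pos hKpos _
  have hs0 : 0 < s := by linarith
  have hκs : κ ^ s = K := by
    rw [hκ, ← Real.rpow_mul hK0, one_div_mul_cancel hs0.ne', Real.rpow_one]
  -- The tangent line inequality multiplies the defect of extremality by s κ^(s-1), so this η costs
  -- at most δ; the bound κ / 2 keeps κ - η positive.
  set η := min (δ / (s * κ ^ (s - 1))) (κ / 2) with hη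
  have hηpos : 0 < η := by positivity
  have hη1 : s * κ ^ (s - 1) * η ≤ δ := by
    have : η ≤ δ / (s * κ ^ (s - 1)) := min_le_left _ _
    rw [le_div_iff₀ (by positivity)] at this
    linarith
  have hη2 : η < κ := (min_le_right _ _).trans_lt (by linarith)
  obtain ⟨_, ⟨m, f, hf, rfl⟩, hlt⟩ := exists_lt_of_lt_csSup hne
    (show (κ - η) ^ s < K by
      rw [← hκs]; exact Real.rpow_lt_rpow (by linarith) (by linarith) hs0)
  set P := ∑ i, ‖V (f i)‖ ^ s with hP
  have hPpos : 0 < P := lt_of_le_of_lt (Real.rpow_nonneg (by linarith) _) hlt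
  set F := P ^ (1 / s) with hF
  have hFs : F ^ s = P := by
    rw [hF, ← Real.rpow_mul hPpos.le, one_div_mul_cancel hs0.ne', Real.rpow_one]
  have hFpos : 0 < F := Real.rpow_pos_of_pos hPpos _
  have hFη : κ - η ≤ F := by
    refine le_of_lt ((Real.rpow_lt_rpow_iff (by linarith) hFpos.le hs0).1 ?_)
    rwa [hFs]
  choose ψ hψ1 hψ2 using fun i => exists_dual_vector'' 𝕜 (V (f i))
  -- These coefficients attain equality in Hölder's inequality, so that Ξ below has Ξ(1) = F, while
  -- its norm is at most κ.
  set c : Fin m → ℝ := fun i => ‖V (f i)‖ ^ (s - 1) / F ^ (s - 1) with hc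
  have hc0 : ∀ i, 0 ≤ c i := fun i => by positivity
  set Ξ : (ι → 𝕜) →ₗ[𝕜] 𝕜 := ∑ i, (c i : 𝕜) •
      ((ψ i : X →ₗ[𝕜] 𝕜) ∘ₗ V ∘ₗ LinearMap.mulLeft 𝕜 (f i)) with hΞ
  have hΞapp : ∀ g, Ξ g = ∑ i, (c i : 𝕜) * ψ i (V (f i * g)) := fun g => by
    simp [hΞ, LinearMap.sum_apply, RCLike.real_smul_eq_coe_mul]
  have hΞle : ∀ g, ‖Ξ g‖ ≤ (∑ i, ‖V (f i * g)‖ ^ s) ^ (1 / s) := fun g => by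
    have h1 : ‖Ξ g‖ ≤ ∑ i, c i * ‖V (f i * g)‖ := by
      rw [hΞapp]
      refine (norm_sum_le _ _).trans (Finset.sum_le_sum fun i _ => ?_)
      rw [norm_mul, RCLike.norm_ofReal, abs_of_nonneg (hc0 i)]
      refine mul_le_mul_of_nonneg_left ?_ (hc0 i)
      exact ((ψ i).le_of_opNorm_le (hψ1 i) _).trans (by rw [one_mul])
    have h2 : ∑ i, c i * ‖V (f i * g)‖ =
        (∑ i, ‖V (f i)‖ ^ (s - 1) * ‖V (f i * g)‖) / F ^ (s - 1) := by
      rw [Finset.sum_div]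
      exact Finset.sum_congr rfl fun i _ => by simp only [hc]; ring
    have h3 := sum_norm_rpow_sub_one_mul_le hs (fun i => ‖V (f i)‖) (fun i => ‖V (f i * g)‖)
      (fun _ => norm_nonneg _) (fun _ => norm_nonneg _)
    have h4 : P ^ ((s - 1) / s) = F ^ (s - 1) := by
      rw [hF, ← Real.rpow_mul hPpos.le]; congr 1; ring
    refine h1.trans ?_
    rw [h2, div_le_iff₀ (by positivity)]
    refine h3.trans (le_of_eq ?_)
    rw [h4, mul_comm]
  have hmul : ∀ g : ι → 𝕜, (∀ j, ‖g j‖ ≤ 1) → ∀ j, ∑ i, ‖(f i * g) j‖ ≤ 1 := fun g hg j => by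
    refine le_trans (Finset.sum_le_sum fun i _ => ?_) (hf j)
    rw [Pi.mul_apply, norm_mul]
    exact mul_le_of_le_one_right (norm_nonneg _) (hg j)
  have hΞκ : ∀ g : ι → 𝕜, (∀ j, ‖g j‖ ≤ 1) → ‖Ξ g‖ ≤ κ := fun g hg =>
    (hΞle g).trans (Real.rpow_le_rpow (by positivity) (hmem m _ (hmul g hg)) (by positivity))
  have hΞ1 : Ξ 1 = (F : 𝕜) := by
    rw [hΞapp]
    simp only [mul_one, hψ2, ← RCLike.ofReal_mul, ← RCLike.ofReal_sum]
    congr 1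
    have : ∀ i, c i * ‖V (f i)‖ = ‖V (f i)‖ ^ s / F ^ (s - 1) := fun i => by
      rw [hc]
      rcases (norm_nonneg (V (f i))).eq_or_lt with h0 | h0
      · rw [← h0, Real.zero_rpow hs0.ne']; simp
      · rw [div_mul_eq_mul_div, ← Real.rpow_add_one h0.ne', sub_add_cancel]
    simp only [this]
    rw [← Finset.sum_div, ← hP, ← hFs, ← Real.rpow_sub hFpos]
    simp
  set ξ : ι → ℝ := fun j => ‖Ξ (Pi.single j 1)‖ with hξ
  refine ⟨fun j => s * κ ^ (s - 1) * ξ j, fun j => by positivity, ?_, fun h hh => ?_⟩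
  · rw [← Finset.mul_sum]
    have h1 := Ξ.sum_norm_apply_single_le hΞκ
    calc s * κ ^ (s - 1) * ∑ j, ξ j ≤ s * κ ^ (s - 1) * κ :=
          mul_le_mul_of_nonneg_left h1 (by positivity)
      _ = s * K := by rw [mul_assoc, ← Real.rpow_add_one hκpos.ne', sub_add_cancel, hκs]
      _ ≤ s * K₀ := mul_le_mul_of_nonneg_left hKK hs0.le
  · set g : ι → 𝕜 := fun j => ((1 - ‖h j‖ : ℝ) : 𝕜) with hg
    have hgn : ∀ j, ‖g j‖ = 1 - ‖h j‖ := fun j => by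
      rw [hg, RCLike.norm_ofReal, abs_of_nonneg (by linarith [hh j])]
    set G := (∑ i, ‖V (f i * g)‖ ^ s) ^ (1 / s) with hG
    have hG0 : 0 ≤ G := by positivity
    have hGs : G ^ s = ∑ i, ‖V (f i * g)‖ ^ s := by
      rw [hG, ← Real.rpow_mul (by positivity), one_div_mul_cancel hs0.ne', Real.rpow_one]
    have h1 : G ^ s + ‖V h‖ ^ s ≤ κ ^ s := by
      -- Perturbing the near-extremal family: |h| + (1 - |h|) ∑ |f_i| ≤ 1, so adjoining h to the f_i
      -- (1 - |h|) stays admissible.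
      have := hmem (m + 1) (Fin.cons h fun i => f i * g) fun j => by
        rw [Fin.sum_univ_succ]
        simp only [Fin.cons_zero, Fin.cons_succ, Pi.mul_apply, norm_mul, hgn]
        rw [← Finset.sum_mul]
        nlinarith [hf j, hh j, norm_nonneg (h j)]
      rw [Fin.sum_univ_succ] at this
      simp only [Fin.cons_zero, Fin.cons_succ] at this
      rw [hGs, hκs]
      linarith
    have h2 : F - ∑ j, ξ j * ‖h j‖ ≤ G := by
      have e : Ξ g = F - Ξ (fun j => (‖h j‖ : 𝕜)) := by
        rw [← hΞ1, ← map_sub]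
        congr 1
        ext j
        simp [hg]
      have e1 := Ξ.norm_apply_le_sum_single (fun j => (‖h j‖ : 𝕜))
      simp only [RCLike.norm_ofReal, abs_norm] at e1
      have e2 := norm_sub_norm_le (F : 𝕜) (Ξ (fun j => (‖h j‖ : 𝕜)))
      rw [← e, RCLike.norm_ofReal, abs_of_pos hFpos] at e2
      linarith [hΞle g]
    have h3 := Real.rpow_sub_rpow_le hs.le hκpos hG0
    have h4 : s * κ ^ (s - 1) * (κ - G) ≤ s * κ ^ (s - 1) * (η + ∑ j, ξ j * ‖h j‖) :=
      mul_le_mul_of_nonneg_left (by linarith) (by positivity)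
    have h5 : ∑ j, s * κ ^ (s - 1) * ξ j * ‖h j‖ = s * κ ^ (s - 1) * ∑ j, ξ j * ‖h j‖ := by
      rw [Finset.mul_sum]
      exact Finset.sum_congr rfl fun j _ => by ring
    rw [h5]
    linarith

/-- The masses are bounded independently of δ, so the weights for δ = 1/(n+1) stay in a compact cube
and a limit point removes the error term. -/
theorem exists_weight_of_summing {s K₀ : ℝ} (hs : 1 < s) (V : (ι → 𝕜) →ₗ[𝕜] X)
    (hV : ∀ (m : ℕ) (f : Fin m → ι → 𝕜), (∀ j, ∑ i, ‖f i j‖ ≤ 1) → ∑ i, ‖V (f i)‖ ^ s ≤ K₀) :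
    ∃ ν : ι → ℝ, (∀ j, 0 ≤ ν j) ∧ ∑ j, ν j ≤ s * K₀ ∧
      ∀ h : ι → 𝕜, (∀ j, ‖h j‖ ≤ 1) → ‖V h‖ ^ s ≤ ∑ j, ν j * ‖h j‖ := by
  choose ν h0 h1 h2 using fun n : ℕ =>
    exists_weight_add_of_summing hs (Nat.one_div_pos_of_nat (n := n) (α := ℝ)) V hV
  have hcpt : IsCompact (Set.pi Set.univ fun _ : ι => Set.Icc (0 : ℝ) (s * K₀)) :=
    isCompact_univ_pi fun _ => isCompact_Icc
  obtain ⟨a, -, φ, hφ, hlim⟩ := hcpt.tendsto_subseq (x := ν) fun n j _ =>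
    ⟨h0 n j, (Finset.single_le_sum (fun j _ => h0 n j) (Finset.mem_univ j)).trans (h1 n)⟩
  rw [tendsto_pi_nhds] at hlim
  refine ⟨a, fun j => ge_of_tendsto' (hlim j) fun n => h0 _ j,
    le_of_tendsto' (tendsto_finsetSum _ fun j _ => hlim j) fun n => h1 _, fun h hh => ?_⟩
  have hl : Filter.Tendsto (fun n => ∑ j, ν (φ n) j * ‖h j‖ + 1 / ((φ n : ℕ) + 1 : ℝ))
      Filter.atTop (nhds (∑ j, a j * ‖h j‖ + 0)) :=
    (tendsto_finsetSum _ fun j _ => (hlim j).mul_const _).add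
      (tendsto_one_div_add_atTop_nhds_zero_nat.comp hφ.tendsto_atTop)
  rw [add_zero] at hl
  exact ge_of_tendsto' hl fun n => h2 _ h hh

/-- The inequality defining cotype `s`, with constant `C`. -/
def CotypeWith (X : Type u) [NormedAddCommGroup X] (s C : ℝ) : Prop :=
  ∀ (m : ℕ) (x : Fin m → X), (∑ i, ‖x i‖ ^ s) ^ (1 / s) ≤
      C * √((∑ ε : Fin m → ℤˣ, ‖∑ i, (ε i : ℤ) • x i‖ ^ 2) / 2 ^ m)

theorem card_signs (m : ℕ) : (Fintype.card (Fin m → ℤˣ) : ℝ) = 2 ^ m := by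
  simp

theorem CotypeWith.sum_norm_rpow_le {s C M : ℝ} (hX : CotypeWith X s C) (hs : 0 < s) (hC : 0 ≤ C)
    {m : ℕ} (x : Fin m → X)
    (hM : (∑ ε : Fin m → ℤˣ, ‖∑ i, (ε i : ℤ) • x i‖ ^ 2) / 2 ^ m ≤ M) :
    ∑ i, ‖x i‖ ^ s ≤ (C * √M) ^ s := by
  have h1 := (hX m x).trans (mul_le_mul_of_nonneg_left (Real.sqrt_le_sqrt hM) hC)
  have h2 := Real.rpow_le_rpow (by positivity) h1 hs.le
  rwa [← Real.rpow_mul (by positivity), one_div_mul_cancel hs.ne', Real.rpow_one] at h2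

-- Pointwise |∑ ε_i f_i| ≤ ∑ |f_i| ≤ 1 for every choice of signs, so the Rademacher average in the
-- cotype inequality is at most 1.
omit [Fintype ι] in
theorem CotypeWith.summing {s C : ℝ} (hX : CotypeWith X s C) (hs : 0 < s) (hC : 0 ≤ C)
    (V : (ι → 𝕜) →ₗ[𝕜] X) (hV : ∀ g : ι → 𝕜, (∀ j, ‖g j‖ ≤ 1) → ‖V g‖ ≤ 1)
    (m : ℕ) (f : Fin m → ι → 𝕜) (hf : ∀ j, ∑ i, ‖f i j‖ ≤ 1) : ∑ i, ‖V (f i)‖ ^ s ≤ C ^ s := by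
  have h := hX.sum_norm_rpow_le hs hC (fun i => V (f i)) (M := 1) ?_
  · simpa using h
  rw [div_le_one (by positivity), ← card_signs]
  refine (Finset.sum_le_card_nsmul _ _ 1 fun ε _ => ?_).trans (by simp)
  have : ∑ i, (ε i : ℤ) • V (f i) = V (∑ i, (ε i : ℤ) • f i) := by
    simp only [map_sum, map_zsmul]
  rw [this]
  refine pow_le_one₀ (norm_nonneg _) (hV _ fun j => ?_)
  rw [Finset.sum_apply]
  refine (norm_sum_le _ _).trans (le_trans (Finset.sum_le_sum fun i _ => ?_) (hf j))
  rcases Int.units_eq_one_or (ε i) with h | h <;> simp [h]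

theorem CotypeWith.exists_weight {s C : ℝ} (hX : CotypeWith X s C) (hs : 1 < s) (hC : 0 ≤ C)
    (V : (ι → 𝕜) →ₗ[𝕜] X) (hV : ∀ g : ι → 𝕜, (∀ j, ‖g j‖ ≤ 1) → ‖V g‖ ≤ 1) :
    ∃ ν : ι → ℝ, (∀ j, 0 ≤ ν j) ∧ ∑ j, ν j ≤ s * C ^ s ∧
      ∀ h : ι → 𝕜, (∀ j, ‖h j‖ ≤ 1) → ‖V h‖ ^ s ≤ ∑ j, ν j * ‖h j‖ :=
  exists_weight_of_summing hs V (hX.summing (by linarith) hC V hV)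

end FiniteSup

/-! ### From domination by a weight to t-concavity. -/

section Concavity

variable {𝕜 : Type w} [RCLike 𝕜] {X : Type u} [NormedAddCommGroup X] [NormedSpace 𝕜 X]
  {ι : Type*} [Fintype ι]

/-- Dyadic layers: the part of f with values between 2^n and 2^(n+1) lives on a set of ν-mass at
most 2^(-nt), so its image has norm at most 2^(n+1) 2^(-nt/s). These bounds form a geometric series,
convergent when s < t. -/
theorem norm_apply_le_of_weight_of_le_two_pow {s t : ℝ} (hs : 0 < s) (ht : 0 < t)
    (V : (ι → 𝕜) →ₗ[𝕜] X)
    (hV : ∀ g : ι → 𝕜, (∀ j, ‖g j‖ ≤ 1) → ‖V g‖ ≤ 1) {ν : ι → ℝ} (hν : ∀ j, 0 ≤ ν j)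
    (hVν : ∀ h : ι → 𝕜, (∀ j, ‖h j‖ ≤ 1) → ‖V h‖ ^ s ≤ ∑ j, ν j * ‖h j‖) (n : ℕ) :
    ∀ f : ι → 𝕜, ∑ j, ν j * ‖f j‖ ^ t ≤ 1 → (∀ j, ‖f j‖ ≤ 2 ^ n) →
      ‖V f‖ ≤ 1 + 2 * ∑ k ∈ Finset.range n, ((2 : ℝ) ^ (1 - t / s)) ^ k := by
  induction n with
  | zero => intro f _ hf; simpa using hV f (by simpa using hf)
  | succ n ih =>
    intro f hf1 hf2
    classical
    set f₁ : ι → 𝕜 := fun j => if ‖f j‖ ≤ 2 ^ n then f j else 0 with hf₁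
    set h : ι → 𝕜 := fun j => if ‖f j‖ ≤ 2 ^ n then 0 else ((2 ^ (n + 1) : ℝ)⁻¹ : ℝ) • f j with hh
    have hsum : f = f₁ + (2 ^ (n + 1) : ℝ) • h := by
      ext j
      simp only [hf₁, hh, Pi.add_apply, Pi.smul_apply]
      split_ifs
      · simp
      · rw [smul_smul, mul_inv_cancel₀ (by positivity)]; simp
    have hf₁le : ∀ j, ‖f₁ j‖ ≤ ‖f j‖ := fun j => by
      simp only [hf₁]; split_ifs <;> simp
    have h1 := ih f₁
      (le_trans (Finset.sum_le_sum fun j _ => mul_le_mul_of_nonneg_left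
        (Real.rpow_le_rpow (norm_nonneg _) (hf₁le j) ht.le) (hν j)) hf1)
      (fun j => by simp only [hf₁]; split_ifs with hj <;> simp [hj])
    have hhle : ∀ j, ‖h j‖ ≤ 1 := fun j => by
      simp only [hh]
      split_ifs
      · simp
      · rw [norm_smul, Real.norm_of_nonneg (by positivity), inv_mul_le_one₀ (by positivity)]
        exact hf2 j
    -- Chebyshev's inequality, as |h| ≤ 1 is supported where |f| > 2^n.
    have hhν : ∑ j, ν j * ‖h j‖ ≤ ((2 : ℝ) ^ n) ^ (-t) := by
      have hterm : ∀ j, ν j * ‖h j‖ ≤ ((2 : ℝ) ^ n) ^ (-t) * (ν j * ‖f j‖ ^ t) := fun j => by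
        by_cases hj : ‖f j‖ ≤ 2 ^ n
        · have : h j = 0 := by simp only [hh, if_pos hj]
          rw [this, norm_zero, mul_zero]
          have := hν j
          positivity
        · have h3 : ((2 : ℝ) ^ n) ^ t ≤ ‖f j‖ ^ t :=
            Real.rpow_le_rpow (by positivity) (not_le.1 hj).le ht.le
          have h4 : 1 ≤ ((2 : ℝ) ^ n) ^ (-t) * ‖f j‖ ^ t := by
            rw [Real.rpow_neg (by positivity), inv_mul_eq_div, one_le_div (by positivity)]
            exact h3
          calc ν j * ‖h j‖ ≤ ν j * 1 := mul_le_mul_of_nonneg_left (hhle j) (hν j)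
            _ ≤ ν j * (((2 : ℝ) ^ n) ^ (-t) * ‖f j‖ ^ t) := mul_le_mul_of_nonneg_left h4 (hν j)
            _ = _ := by ring
      refine (Finset.sum_le_sum fun j _ => hterm j).trans ?_
      rw [← Finset.mul_sum]
      exact mul_le_of_le_one_right (by positivity) hf1
    have h2 : ‖V h‖ ≤ ((2 : ℝ) ^ (-(t / s))) ^ n := by
      have := (hVν h hhle).trans hhν
      have h3 := Real.rpow_le_rpow (by positivity) this (one_div_pos.2 hs).le
      rw [← Real.rpow_mul (norm_nonneg _), mul_one_div_cancel hs.ne', Real.rpow_one] at h3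
      refine h3.trans (le_of_eq ?_)
      rw [← Real.rpow_natCast, ← Real.rpow_natCast, ← Real.rpow_mul (by norm_num),
        ← Real.rpow_mul (by norm_num), ← Real.rpow_mul (by norm_num)]
      congr 1
      field_simp
    have h3 : ‖V f‖ ≤ ‖V f₁‖ + 2 ^ (n + 1) * ‖V h‖ := by
      rw [hsum, map_add, ← algebraMap_smul 𝕜 ((2 : ℝ) ^ (n + 1)) h, map_smul]
      refine (norm_add_le _ _).trans (le_of_eq ?_)
      rw [norm_smul, norm_algebraMap', Real.norm_of_nonneg (by positivity)]
    rw [Finset.sum_range_succ]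
    have h4 : ((2 : ℝ) ^ (1 - t / s)) ^ n = 2 ^ n * ((2 : ℝ) ^ (-(t / s))) ^ n := by
      rw [sub_eq_add_neg, Real.rpow_add (by norm_num), Real.rpow_one, mul_pow]
    rw [h4]
    have h5 : (2 : ℝ) ^ (n + 1) * ‖V h‖ ≤ 2 ^ (n + 1) * ((2 : ℝ) ^ (-(t / s))) ^ n :=
      mul_le_mul_of_nonneg_left h2 (by positivity)
    rw [pow_succ] at h5 h3
    linarith

/-- The constant in the passage from `(s, 1)`-summing to `t`-summing operators, `s < t`. -/
noncomputable def dominationConst (s t : ℝ) : ℝ := 1 + 2 * (1 - (2 : ℝ) ^ (1 - t / s))⁻¹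

theorem dominationConst_pos {s t : ℝ} (hs : 0 < s) (hst : s < t) : 0 < dominationConst s t := by
  have : (2 : ℝ) ^ (1 - t / s) < 1 := Real.rpow_lt_one_of_one_lt_of_neg (by norm_num) (by
    rw [sub_neg, one_lt_div hs]; exact hst)
  have : 0 < 1 - (2 : ℝ) ^ (1 - t / s) := by linarith
  unfold dominationConst
  positivity

theorem norm_apply_le_of_weight {s t : ℝ} (hs : 0 < s) (hst : s < t) (V : (ι → 𝕜) →ₗ[𝕜] X)
    (hV : ∀ g : ι → 𝕜, (∀ j, ‖g j‖ ≤ 1) → ‖V g‖ ≤ 1) {ν : ι → ℝ} (hν : ∀ j, 0 ≤ ν j)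
    (hVν : ∀ h : ι → 𝕜, (∀ j, ‖h j‖ ≤ 1) → ‖V h‖ ^ s ≤ ∑ j, ν j * ‖h j‖)
    (f : ι → 𝕜) (hf : ∑ j, ν j * ‖f j‖ ^ t ≤ 1) : ‖V f‖ ≤ dominationConst s t := by
  obtain ⟨n, hn⟩ := pow_unbounded_of_one_lt ‖f‖ (one_lt_two : (1 : ℝ) < 2)
  refine (norm_apply_le_of_weight_of_le_two_pow hs (hs.trans hst) V hV hν hVν n f hf
    fun j => (norm_le_pi_norm f j).trans hn.le).trans ?_
  have hlt : (2 : ℝ) ^ (1 - t / s) < 1 := Real.rpow_lt_one_of_one_lt_of_neg (by norm_num) (by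
    rw [sub_neg, one_lt_div hs]; exact hst)
  have h0 : 0 ≤ (2 : ℝ) ^ (1 - t / s) := by positivity
  have := (summable_geometric_of_lt_one h0 hlt).sum_le_tsum (Finset.range n)
    fun k _ => pow_nonneg h0 k
  rw [tsum_geometric_of_lt_one h0 hlt] at this
  unfold dominationConst
  linarith

theorem norm_apply_rpow_le_of_weight {s t : ℝ} (hs : 0 < s) (hst : s < t) (V : (ι → 𝕜) →ₗ[𝕜] X)
    (hV : ∀ g : ι → 𝕜, (∀ j, ‖g j‖ ≤ 1) → ‖V g‖ ≤ 1) {ν : ι → ℝ} (hν : ∀ j, 0 ≤ ν j)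
    (hVν : ∀ h : ι → 𝕜, (∀ j, ‖h j‖ ≤ 1) → ‖V h‖ ^ s ≤ ∑ j, ν j * ‖h j‖)
    (f : ι → 𝕜) : ‖V f‖ ^ t ≤ dominationConst s t ^ t * ∑ j, ν j * ‖f j‖ ^ t := by
  have ht : 0 < t := hs.trans hst
  have hK := dominationConst_pos hs hst
  set A := ∑ j, ν j * ‖f j‖ ^ t with hA
  have hA0 : 0 ≤ A := Finset.sum_nonneg fun j _ => mul_nonneg (hν j) (by positivity)
  -- Homogeneity; rescaling by B rather than A covers A = 0, and B then decreases to A.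
  have key : ∀ B, 0 < B → A ≤ B → ‖V f‖ ^ t ≤ dominationConst s t ^ t * B := fun B hB hAB => by
    have hb : 0 < B ^ (1 / t) := by positivity
    have hbt : (B ^ (1 / t)) ^ t = B := by
      rw [← Real.rpow_mul hB.le, one_div_mul_cancel ht.ne', Real.rpow_one]
    have hn : ‖((B ^ (1 / t) : ℝ) : 𝕜)⁻¹‖ = (B ^ (1 / t))⁻¹ := by
      rw [norm_inv, RCLike.norm_ofReal, abs_of_pos hb]
    have h1 := norm_apply_le_of_weight hs hst V hV hν hVν (((B ^ (1 / t) : ℝ) : 𝕜)⁻¹ • f) (by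
      have : ∀ j, ν j * ‖(((B ^ (1 / t) : ℝ) : 𝕜)⁻¹ • f) j‖ ^ t = ν j * ‖f j‖ ^ t / B := fun j => by
        rw [Pi.smul_apply, norm_smul, hn, Real.mul_rpow (by positivity) (by positivity),
          Real.inv_rpow hb.le, hbt]
        ring
      simp only [this]
      rw [← Finset.sum_div, div_le_one hB]
      exact hAB)
    rw [map_smul, norm_smul, hn, inv_mul_le_iff₀ hb] at h1
    have h2 := Real.rpow_le_rpow (norm_nonneg _) h1 ht.le
    rw [Real.mul_rpow hb.le hK.le, hbt] at h2
    linarith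
  have hlim : Filter.Tendsto (fun B : ℝ => dominationConst s t ^ t * B) (nhdsWithin A (Set.Ioi A))
      (nhds (dominationConst s t ^ t * A)) :=
    (Filter.Tendsto.const_mul _ Filter.tendsto_id).mono_left nhdsWithin_le_nhds
  refine ge_of_tendsto hlim ?_
  filter_upwards [self_mem_nhdsWithin] with B hB
  exact key B (hA0.trans_lt hB) (le_of_lt hB)

theorem Fin.sum_signs_succ {m : ℕ} {M : Type*} [AddCommMonoid M] (F : (Fin (m + 1) → ℤˣ) → M) :
    ∑ ε, F ε = ∑ ε : Fin m → ℤˣ, (F (Fin.cons 1 ε) + F (Fin.cons (-1) ε)) := by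
  rw [← (Fin.consEquiv fun _ : Fin (m + 1) => ℤˣ).sum_comp, Fintype.sum_prod_type,
    UnitsInt.univ, Finset.sum_pair (by decide), Finset.sum_add_distrib]
  rfl

theorem sum_signs_norm_sq {m : ℕ} (a : Fin m → 𝕜) :
    ∑ ε : Fin m → ℤˣ, ‖∑ i, (ε i : ℤ) • a i‖ ^ 2 = 2 ^ m * ∑ i, ‖a i‖ ^ 2 := by
  induction m with
  | zero => simp
  | succ m ih =>
    rw [Fin.sum_signs_succ]
    simp only [Fin.sum_univ_succ, Fin.cons_zero, Fin.cons_succ]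
    have : ∀ ε : Fin m → ℤˣ,
        ‖((1 : ℤˣ) : ℤ) • a 0 + ∑ i, (ε i : ℤ) • a i.succ‖ ^ 2 +
        ‖((-1 : ℤˣ) : ℤ) • a 0 + ∑ i, (ε i : ℤ) • a i.succ‖ ^ 2 =
        2 * ‖a 0‖ ^ 2 + 2 * ‖∑ i, (ε i : ℤ) • a i.succ‖ ^ 2 := fun ε => by
      have h := parallelogram_law_with_norm 𝕜 (∑ i, (ε i : ℤ) • a i.succ) (a 0)
      simp only [Units.val_one, one_smul, Units.val_neg, neg_smul]
      rw [add_comm (a 0), neg_add_eq_sub]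
      nlinarith
    simp only [this]
    rw [Finset.sum_add_distrib, ← Finset.mul_sum, ← Finset.mul_sum, ih (fun i => a i.succ)]
    simp only [Finset.sum_const, Finset.card_univ, nsmul_eq_mul, card_signs]
    ring

/-- Khinchin's inequality for fourth moments, by induction: averaging over the sign of a_0 gives at
most |a_0|^4 + 6 |a_0|^2 |S|^2 + |S|^4, and 3σ^2 + 6σ|a_0|^2 + |a_0|^4 ≤ 3(σ + |a_0|^2)^2. -/
theorem sum_signs_norm_pow_four_le {m : ℕ} (a : Fin m → 𝕜) :
    ∑ ε : Fin m → ℤˣ, ‖∑ i, (ε i : ℤ) • a i‖ ^ 4 ≤ 2 ^ m * (3 * (∑ i, ‖a i‖ ^ 2) ^ 2) := by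
  induction m with
  | zero => simp
  | succ m ih =>
    rw [Fin.sum_signs_succ]
    simp only [Fin.sum_univ_succ, Fin.cons_zero, Fin.cons_succ]
    have : ∀ ε : Fin m → ℤˣ,
        ‖((1 : ℤˣ) : ℤ) • a 0 + ∑ i, (ε i : ℤ) • a i.succ‖ ^ 4 +
        ‖((-1 : ℤˣ) : ℤ) • a 0 + ∑ i, (ε i : ℤ) • a i.succ‖ ^ 4 ≤
        2 * ‖a 0‖ ^ 4 + (12 * ‖a 0‖ ^ 2) * ‖∑ i, (ε i : ℤ) • a i.succ‖ ^ 2 +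
          2 * ‖∑ i, (ε i : ℤ) • a i.succ‖ ^ 4 := fun ε => by
      simp only [Units.val_one, one_smul, Units.val_neg, neg_smul]
      set S := ∑ i, (ε i : ℤ) • a i.succ
      rw [add_comm (a 0), neg_add_eq_sub]
      have h1 := norm_add_sq (𝕜 := 𝕜) S (a 0)
      have h2 := norm_sub_sq (𝕜 := 𝕜) S (a 0)
      set c := RCLike.re (inner 𝕜 S (a 0))
      have h3 : |c| ≤ ‖S‖ * ‖a 0‖ := (RCLike.abs_re_le_norm _).trans (norm_inner_le_norm _ _)
      have h4 : c ^ 2 ≤ (‖S‖ * ‖a 0‖) ^ 2 := sq_le_sq' (by linarith [neg_abs_le c])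
        ((le_abs_self c).trans h3)
      have e1 : ‖S + a 0‖ ^ 4 = (‖S + a 0‖ ^ 2) ^ 2 := by ring
      have e2 : ‖S - a 0‖ ^ 4 = (‖S - a 0‖ ^ 2) ^ 2 := by ring
      rw [e1, e2, h1, h2]
      nlinarith
    refine (Finset.sum_le_sum fun ε _ => this ε).trans ?_
    rw [Finset.sum_add_distrib, Finset.sum_add_distrib, ← Finset.mul_sum, ← Finset.mul_sum,
      ← Finset.mul_sum, sum_signs_norm_sq (fun i => a i.succ)]
    have := ih (fun i => a i.succ)
    simp only [Finset.sum_const, Finset.card_univ, nsmul_eq_mul, card_signs]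
    set σ := ∑ i : Fin m, ‖a i.succ‖ ^ 2
    have h2 : (0 : ℝ) < 2 ^ m := by positivity
    have h3 : 0 ≤ (2 : ℝ) ^ m * ‖a 0‖ ^ 4 := by positivity
    rw [pow_succ (2 : ℝ) m]
    nlinarith

/-- Every operator from a finite dimensional sup-normed space to `X` is `t`-concave, with a
constant that depends only on `X`. -/
def SupConcave (𝕜 : Type w) [RCLike 𝕜] (X : Type u) [NormedAddCommGroup X] [NormedSpace 𝕜 X]
    (t D : ℝ) : Prop :=
  ∀ (ι : Type) [Fintype ι] (V : (ι → 𝕜) →ₗ[𝕜] X),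
    (∀ g : ι → 𝕜, (∀ j, ‖g j‖ ≤ 1) → ‖V g‖ ≤ 1) →
    ∀ (m : ℕ) (c : Fin m → ι → 𝕜), (∀ j, ∑ i, ‖c i j‖ ^ t ≤ 1) → ∑ i, ‖V (c i)‖ ^ t ≤ D

theorem CotypeWith.supConcave_of_lt {s t C : ℝ} (hX : CotypeWith X s C) (hs : 1 < s) (hC : 0 ≤ C)
    (hst : s < t) : SupConcave 𝕜 X t (dominationConst s t ^ t * (s * C ^ s)) := by
  intro ι _ V hV m c hc
  obtain ⟨ν, hν0, hν1, hν⟩ := hX.exists_weight hs hC V hV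
  have hs0 : 0 < s := by linarith
  refine (Finset.sum_le_sum fun i _ =>
    norm_apply_rpow_le_of_weight hs0 hst V hV hν0 hν (c i)).trans ?_
  rw [← Finset.mul_sum]
  refine mul_le_mul_of_nonneg_left ?_ (Real.rpow_nonneg (dominationConst_pos hs0 hst).le _)
  rw [Finset.sum_comm]
  refine le_trans (Finset.sum_le_sum fun j _ => ?_) hν1
  rw [← Finset.mul_sum]
  exact mul_le_of_le_one_right (hν0 j) (hc j)

/-- The endpoint t = s = 2, out of reach of the dyadic argument. Cotype 2 is applied to the vectors
V(c_i): the second moment of their Rademacher sum is at most 1 plus the fourth, which the L_4(ν)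
domination and Khinchin's inequality control. -/
theorem CotypeWith.supConcave_two {C : ℝ} (hX : CotypeWith X 2 C) (hC : 0 ≤ C) :
    SupConcave 𝕜 X 2
      ((C * √(1 + dominationConst 2 4 ^ (4 : ℝ) * (3 * (2 * C ^ (2 : ℝ))))) ^ (2 : ℝ)) := by
  intro ι _ V hV m c hc
  obtain ⟨ν, hν0, hν1, hν⟩ := hX.exists_weight (by norm_num) hC V hV
  refine hX.sum_norm_rpow_le (by norm_num) hC (fun i => V (c i)) ?_
  rw [div_le_iff₀ (by positivity)]
  set L := dominationConst 2 4 ^ (4 : ℝ) with hL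
  have hL0 : 0 ≤ L := Real.rpow_nonneg (dominationConst_pos (by norm_num) (by norm_num)).le _
  have h1 : ∀ ε : Fin m → ℤˣ, ‖∑ i, (ε i : ℤ) • V (c i)‖ ^ 2 ≤
      1 + L * ∑ j, ν j * ‖∑ i, (ε i : ℤ) • c i j‖ ^ 4 := fun ε => by
    have e : ∑ i, (ε i : ℤ) • V (c i) = V (∑ i, (ε i : ℤ) • c i) := by
      simp only [map_sum, map_zsmul]
    have h2 := norm_apply_rpow_le_of_weight (by norm_num) (by norm_num : (2 : ℝ) < 4) V hV hν0 hν
      (∑ i, (ε i : ℤ) • c i)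
    simp only [← hL, Finset.sum_apply, Pi.smul_apply] at h2
    norm_cast at h2
    rw [e]
    have h3 := sq_nonneg (‖V (∑ i, (ε i : ℤ) • c i)‖ ^ 2 - 1)
    have h4 := sq_nonneg ‖V (∑ i, (ε i : ℤ) • c i)‖
    have h5 : ‖V (∑ i, (ε i : ℤ) • c i)‖ ^ 2 ≤ 1 + ‖V (∑ i, (ε i : ℤ) • c i)‖ ^ 4 := by
      nlinarith
    linarith
  refine (Finset.sum_le_sum fun ε _ => h1 ε).trans ?_
  rw [Finset.sum_add_distrib, ← Finset.mul_sum, Finset.sum_comm]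
  simp only [Finset.sum_const, Finset.card_univ, nsmul_eq_mul, card_signs, ← Finset.mul_sum]
  have h6 : ∑ j, ν j * ∑ ε : Fin m → ℤˣ, ‖∑ i, (ε i : ℤ) • c i j‖ ^ 4 ≤
      (2 * C ^ (2 : ℝ)) * (2 ^ m * 3) := by
    calc _ ≤ ∑ j, ν j * (2 ^ m * 3) := Finset.sum_le_sum fun j _ => by
            refine mul_le_mul_of_nonneg_left ?_ (hν0 j)
            refine (sum_signs_norm_pow_four_le fun i => c i j).trans ?_
            have h7 : ∑ i, ‖c i j‖ ^ 2 ≤ 1 := by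
              have := hc j
              norm_cast at this
            have h8 : 0 ≤ ∑ i, ‖c i j‖ ^ 2 := by positivity
            have h9 : (∑ i, ‖c i j‖ ^ 2) ^ 2 ≤ 1 := pow_le_one₀ h8 h7
            refine mul_le_mul_of_nonneg_left ?_ (by positivity)
            linarith
      _ ≤ _ := by
            rw [← Finset.sum_mul]
            exact mul_le_mul_of_nonneg_right hν1 (by positivity)
  have h7 := mul_le_mul_of_nonneg_left h6 hL0
  linarith

/-- The range condition says exactly that s < q^*, or s = 2 ≤ q^*; only q^* = s = 2 needs the
endpoint case. -/
theorem HasCotype.exists_supConcave {s p q : ℝ} (hX : HasCotype X s) (h : CotypeRange s p q)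
    (hpq : p < q) : ∃ D, 0 < D ∧ SupConcave 𝕜 X q.conjExponent D := by
  obtain ⟨hs, C', hC'⟩ := hX
  obtain ⟨hp, -, hr⟩ := h
  have hC : CotypeWith X s (max C' 0) := fun m x => (hC' m x).trans
    (mul_le_mul_of_nonneg_right (le_max_left _ _) (Real.sqrt_nonneg _))
  have hpos : ∀ {t D : ℝ}, SupConcave 𝕜 X t D → ∃ D, 0 < D ∧ SupConcave 𝕜 X t D := fun {t D} hD =>
    ⟨max D 1, by positivity, fun ι _ V hV m c hc => (hD ι V hV m c hc).trans (le_max_left _ _)⟩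
  have hlt : s < q.conjExponent → ∃ D, 0 < D ∧ SupConcave 𝕜 X q.conjExponent D := fun hst =>
    hpos (hC.supConcave_of_lt (by linarith) (le_max_right _ _) hst)
  have hq1 : 1 < q := by linarith
  rcases hr with ⟨hs2, hqs⟩ | ⟨rfl, hq2⟩
  · apply hlt
    rw [Real.conjExponent, lt_div_iff₀ (by linarith)] at *
    nlinarith
  · rcases hq2.eq_or_lt with rfl | hq2
    · have : (2 : ℝ).conjExponent = 2 := by norm_num [Real.conjExponent]
      rw [this]
      exact hpos (hC.supConcave_two (le_max_right _ _))
    · apply hlt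
      rw [Real.conjExponent, lt_div_iff₀ (by linarith)]
      linarith

end Concavity

/-! ### Factorization of weakly summable sequences. -/

section Factorization

variable {𝕜 : Type w} [RCLike 𝕜] {X : Type u} [NormedAddCommGroup X] [NormedSpace 𝕜 X]

theorem weaklySummable_iff {p : ℝ} (hp : 0 < p) {x : ℕ → X} :
    WeaklySummable 𝕜 p x ↔ ∀ φ : StrongDual 𝕜 X, Summable fun j => ‖φ (x j)‖ ^ p := by
  unfold WeaklySummable
  refine forall_congr' fun φ => ?_
  rw [memℓp_gen_iff (by rwa [ENNReal.toReal_ofReal hp.le]), ENNReal.toReal_ofReal hp.le]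

theorem Real.add_rpow_le_two_rpow_mul {p a b : ℝ} (hp : 0 ≤ p) (ha : 0 ≤ a) (hb : 0 ≤ b) :
    (a + b) ^ p ≤ 2 ^ p * (a ^ p + b ^ p) := by
  have h1 : (a + b) ^ p ≤ (2 * max a b) ^ p :=
    Real.rpow_le_rpow (by positivity) (by linarith [le_max_left a b, le_max_right a b]) hp
  rw [Real.mul_rpow (by norm_num) (by positivity)] at h1
  refine h1.trans (mul_le_mul_of_nonneg_left ?_ (by positivity))
  have := Real.rpow_nonneg ha p
  have := Real.rpow_nonneg hb p
  rcases max_choice a b with h | h <;> rw [h] <;> linarith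

/-- Uniform boundedness for weakly summable sequences. -/
theorem WeaklySummable.exists_sum_le {p : ℝ} (hp : 0 < p) {x : ℕ → X}
    (hx : WeaklySummable 𝕜 p x) : ∃ M : ℝ, 0 < M ∧ ∀ φ : StrongDual 𝕜 X, ‖φ‖ ≤ 1 →
      ∀ S : Finset ℕ, ∑ j ∈ S, ‖φ (x j)‖ ^ p ≤ M := by
  rw [weaklySummable_iff hp] at hx
  -- Baire's theorem on the dual: some E n contains a ball, and translating it to the origin costs
  -- only constants.
  set E : ℕ → Set (StrongDual 𝕜 X) := fun n =>
    {φ | ∀ S : Finset ℕ, ∑ j ∈ S, ‖φ (x j)‖ ^ p ≤ n} with hE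
  have hcl : ∀ n, IsClosed (E n) := fun n => by
    have : E n = ⋂ S : Finset ℕ, {φ | ∑ j ∈ S, ‖φ (x j)‖ ^ p ≤ n} := by
      ext φ; simp [hE]
    rw [this]
    refine isClosed_iInter fun S => isClosed_le (continuous_finsetSum _ fun j _ => ?_)
      continuous_const
    exact Continuous.rpow_const (by fun_prop) fun _ => Or.inr hp.le
  have hun : ⋃ n, E n = Set.univ := by
    refine Set.eq_univ_of_forall fun φ => ?_
    obtain ⟨n, hn⟩ := exists_nat_ge (∑' j, ‖φ (x j)‖ ^ p)
    exact Set.mem_iUnion.2 ⟨n, fun S =>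
      ((hx φ).sum_le_tsum S fun j _ => by positivity).trans hn⟩
  obtain ⟨n, φ₀, hφ₀⟩ := nonempty_interior_of_iUnion_of_closed hcl hun
  obtain ⟨ε, hε, hball⟩ := Metric.isOpen_iff.1 isOpen_interior φ₀ hφ₀
  have h0 : φ₀ ∈ E n := interior_subset hφ₀
  refine ⟨(2 / ε) ^ p * (2 ^ p * (n + n)) + 1, by positivity, fun φ hφ S => ?_⟩
  have h1 : φ₀ + ((ε / 2 : ℝ) : 𝕜) • φ ∈ E n := by
    refine interior_subset (hball ?_)
    rw [Metric.mem_ball, dist_eq_norm, add_sub_cancel_left, norm_smul, RCLike.norm_ofReal,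
      abs_of_pos (by positivity)]
    nlinarith
  have hterm : ∀ j, ‖φ (x j)‖ ^ p ≤ (2 / ε) ^ p *
      (2 ^ p * (‖(φ₀ + ((ε / 2 : ℝ) : 𝕜) • φ) (x j)‖ ^ p + ‖φ₀ (x j)‖ ^ p)) := fun j => by
    have h2 : ‖φ (x j)‖ ≤ (2 / ε) * (‖(φ₀ + ((ε / 2 : ℝ) : 𝕜) • φ) (x j)‖ + ‖φ₀ (x j)‖) := by
      have h3 := norm_sub_le ((φ₀ + ((ε / 2 : ℝ) : 𝕜) • φ) (x j)) (φ₀ (x j))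
      rw [add_apply, add_sub_cancel_left, smul_apply,
        norm_smul, RCLike.norm_ofReal, abs_of_pos (by positivity)] at h3
      rw [div_mul_eq_mul_div, le_div_iff₀ hε, add_apply,
        smul_apply]
      linarith
    refine (Real.rpow_le_rpow (norm_nonneg _) h2 hp.le).trans ?_
    rw [Real.mul_rpow (by positivity) (by positivity)]
    exact mul_le_mul_of_nonneg_left
      (Real.add_rpow_le_two_rpow_mul hp.le (norm_nonneg _) (norm_nonneg _)) (by positivity)
  refine (Finset.sum_le_sum fun j _ => hterm j).trans ?_
  rw [← Finset.mul_sum, ← Finset.mul_sum, Finset.sum_add_distrib]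
  have h4 : (2 / ε) ^ p * (2 ^ p * (∑ j ∈ S, ‖(φ₀ + ((ε / 2 : ℝ) : 𝕜) • φ) (x j)‖ ^ p +
      ∑ j ∈ S, ‖φ₀ (x j)‖ ^ p)) ≤ (2 / ε) ^ p * (2 ^ p * (n + n)) := by
    refine mul_le_mul_of_nonneg_left (mul_le_mul_of_nonneg_left ?_ (by positivity)) (by positivity)
    exact add_le_add (h1 S) (h0 S)
  linarith

/-- Hölder's inequality after splitting y = y^(p/r) y^(p/q). -/
theorem Real.sum_mul_le_of_sum_rpow_le_one {ι : Type*} [Fintype ι] {p q r t : ℝ} (hp : 0 < p)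
    (hqt : q.HolderConjugate t) (hrpq : p / r + p / q = 1) {b y : ι → ℝ}
    (hb : ∀ j, 0 ≤ b j) (hy : ∀ j, 0 ≤ y j) (hy1 : ∑ j, y j ^ p ≤ 1) :
    ∑ j, b j * y j ≤ (∑ j, b j ^ t * y j ^ (p * t / r)) ^ (1 / t) := by
  have hq := hqt.pos
  have ht := hqt.symm.pos
  have h := Real.inner_le_Lp_mul_Lq Finset.univ (fun j => b j * y j ^ (p / r))
    (fun j => y j ^ (p / q)) hqt.symm
  have e0 : ∀ j, b j * y j ^ (p / r) * y j ^ (p / q) = b j * y j := fun j => by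
    rw [mul_assoc, ← Real.rpow_add' (hy j) (by rw [hrpq]; norm_num), hrpq, Real.rpow_one]
  have e1 : ∀ j, |b j * y j ^ (p / r)| ^ t = b j ^ t * y j ^ (p * t / r) := fun j => by
    have := Real.rpow_nonneg (hy j) (p / r)
    rw [abs_of_nonneg (mul_nonneg (hb j) this), Real.mul_rpow (hb j) this, ← Real.rpow_mul (hy j)]
    congr 2; ring
  have e2 : ∀ j, |y j ^ (p / q)| ^ q = y j ^ p := fun j => by
    rw [abs_of_nonneg (Real.rpow_nonneg (hy j) _), ← Real.rpow_mul (hy j)]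
    congr 1; field_simp
  simp only [e0, e1, e2] at h
  refine h.trans (mul_le_of_le_one_right ?_ (Real.rpow_le_one ?_ hy1 (by positivity)))
  · exact Real.rpow_nonneg (Finset.sum_nonneg fun j _ =>
      mul_nonneg (Real.rpow_nonneg (hb j) _) (Real.rpow_nonneg (hy j) _)) _
  · exact Finset.sum_nonneg fun j _ => Real.rpow_nonneg (hy j) _

/-- With b_j = (∑_i |a_ij|^t)^(1/t), the operator g ↦ ∑ g_j b_j x_j has norm at most U^(1/t) by the
split Hölder inequality. Concavity is applied to its normalization and the vectors (a_ij / b_j)_j.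
-/
theorem SupConcave.sum_norm_rpow_le {p q r t D U : ℝ} (hD : SupConcave 𝕜 X t D) (hp : 0 < p)
    (hqt : q.HolderConjugate t) (hrpq : p / r + p / q = 1) (hU : 0 < U)
    {ι : Type} [Fintype ι] {κ : Type*} [Fintype κ] (x : ι → X)
    (hx : ∀ φ : StrongDual 𝕜 X, ‖φ‖ ≤ 1 → ∑ j, ‖φ (x j)‖ ^ p ≤ 1) (a : κ → ι → 𝕜)
    (hxU : ∀ φ : StrongDual 𝕜 X, ‖φ‖ ≤ 1 →
      ∑ j, (∑ i, ‖a i j‖ ^ t) * ‖φ (x j)‖ ^ (p * t / r) ≤ U) :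
    ∑ i, ‖∑ j, a i j • x j‖ ^ t ≤ D * U := by
  have ht := hqt.symm.pos
  set B : ι → ℝ := fun j => ∑ i, ‖a i j‖ ^ t with hB
  have hB0 : ∀ j, 0 ≤ B j := fun j => by positivity
  set b : ι → ℝ := fun j => B j ^ (1 / t) with hb
  have hb0 : ∀ j, 0 ≤ b j := fun j => Real.rpow_nonneg (hB0 j) _
  have hbt : ∀ j, b j ^ t = B j := fun j => by
    rw [hb, ← Real.rpow_mul (hB0 j), one_div_mul_cancel ht.ne', Real.rpow_one]
  set u : ℝ := U ^ (1 / t) with hu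
  have hu0 : 0 < u := by positivity
  have hut : u ^ t = U := by
    rw [hu, ← Real.rpow_mul hU.le, one_div_mul_cancel ht.ne', Real.rpow_one]
  have hun : ‖((u : ℝ) : 𝕜)⁻¹‖ = u⁻¹ := by
    rw [norm_inv, RCLike.norm_ofReal, abs_of_pos hu0]
  set V : (ι → 𝕜) →ₗ[𝕜] X := Fintype.linearCombination 𝕜 fun j => (u : 𝕜)⁻¹ • (b j : 𝕜) • x j
    with hV
  have hVapp : ∀ g, V g = (u : 𝕜)⁻¹ • ∑ j, (g j * (b j : 𝕜)) • x j := fun g => by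
    simp only [hV, Fintype.linearCombination_apply, Finset.smul_sum]
    refine Finset.sum_congr rfl fun j _ => ?_
    simp only [smul_smul]
    congr 1; ring
  have hV1 : ∀ g : ι → 𝕜, (∀ j, ‖g j‖ ≤ 1) → ‖V g‖ ≤ 1 := fun g hg => by
    rw [hVapp, norm_smul, hun, inv_mul_le_one₀ hu0]
    obtain ⟨φ, hφ1, hφ2⟩ := exists_dual_vector'' 𝕜 (∑ j, (g j * (b j : 𝕜)) • x j)
    have h1 : ‖∑ j, (g j * (b j : 𝕜)) • x j‖ ≤ ∑ j, b j * ‖φ (x j)‖ := by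
      rw [← RCLike.norm_ofReal (K := 𝕜) ‖∑ j, _‖ |>.trans (abs_norm _), ← hφ2, map_sum]
      refine (norm_sum_le _ _).trans (Finset.sum_le_sum fun j _ => ?_)
      rw [map_smul, smul_eq_mul, norm_mul, norm_mul, RCLike.norm_ofReal, abs_of_nonneg (hb0 j)]
      exact mul_le_mul_of_nonneg_right (mul_le_of_le_one_left (hb0 j) (hg j)) (norm_nonneg _)
    refine h1.trans ((Real.sum_mul_le_of_sum_rpow_le_one hp hqt hrpq hb0
      (fun _ => norm_nonneg _) (hx φ hφ1)).trans ?_)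
    simp only [hbt]
    exact Real.rpow_le_rpow (by positivity) (hxU φ hφ1) (by positivity)
  set e := Fintype.equivFin κ
  have h2 := hD ι V hV1 (Fintype.card κ) (fun i j => a (e.symm i) j / (b j : 𝕜)) fun j => by
    rw [e.symm.sum_comp fun i => ‖a i j / (b j : 𝕜)‖ ^ t]
    have : ∀ i, ‖a i j / (b j : 𝕜)‖ ^ t = ‖a i j‖ ^ t / B j := fun i => by
      rw [norm_div, RCLike.norm_ofReal, abs_of_nonneg (hb0 j),
        Real.div_rpow (norm_nonneg _) (hb0 j), hbt]
    simp only [this]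
    rw [← Finset.sum_div]
    exact div_self_le_one _
  rw [e.symm.sum_comp fun i => ‖V fun j => a i j / (b j : 𝕜)‖ ^ t] at h2
  have h3 : ∀ i, ‖V fun j => a i j / (b j : 𝕜)‖ ^ t = ‖∑ j, a i j • x j‖ ^ t / U := fun i => by
    rw [hVapp, norm_smul, hun, Real.mul_rpow (by positivity) (norm_nonneg _),
      Real.inv_rpow hu0.le, hut, inv_mul_eq_div]
    suffices h : ∑ j, (a i j / (b j : 𝕜) * (b j : 𝕜)) • x j = ∑ j, a i j • x j by rw [h]
    refine Finset.sum_congr rfl fun j _ => ?_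
    -- If b_j = 0, all a_ij vanish, so the division by zero is harmless.
    rcases eq_or_ne (b j) 0 with hj | hj
    · have hBj : B j = 0 := by rw [← hbt, hj, Real.zero_rpow ht.ne']
      have := (Finset.sum_eq_zero_iff_of_nonneg fun i _ => by positivity).1 hBj i
        (Finset.mem_univ _)
      rw [Real.rpow_eq_zero (norm_nonneg _) ht.ne', norm_eq_zero] at this
      simp [this]
    · rw [div_mul_cancel₀]
      exact_mod_cast hj
  simp only [h3] at h2
  rwa [← Finset.sum_div, div_le_iff₀ hU] at h2

/-- The positive part of the unit ball of `ℓ_ρ`. -/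
def positiveBall (ρ : ℝ) : Set (ℕ → ℝ) :=
  {w | (∀ j, 0 ≤ w j) ∧ ∀ S : Finset ℕ, ∑ j ∈ S, w j ^ ρ ≤ 1}

theorem isCompact_positiveBall {ρ : ℝ} (hρ : 0 < ρ) : IsCompact (positiveBall ρ) := by
  have hc : IsCompact (Set.pi Set.univ fun _ : ℕ => Set.Icc (0 : ℝ) 1) :=
    isCompact_univ_pi fun _ => isCompact_Icc
  refine hc.of_isClosed_subset ?_ fun w hw j _ => ⟨hw.1 j, ?_⟩
  · refine IsClosed.inter (s₁ := {w : ℕ → ℝ | ∀ j, 0 ≤ w j})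
      (s₂ := {w : ℕ → ℝ | ∀ S : Finset ℕ, ∑ j ∈ S, w j ^ ρ ≤ 1}) ?_ ?_
    · simp only [Set.ofPred_forall]
      exact isClosed_iInter fun j => isClosed_le continuous_const (continuous_apply j)
    · simp only [Set.ofPred_forall]
      refine isClosed_iInter fun S => isClosed_le (continuous_finsetSum _ fun j _ => ?_)
        continuous_const
      exact (continuous_apply j).rpow_const fun _ => Or.inr hρ.le
  · have := hw.2 {j}
    rw [Finset.sum_singleton] at this
    by_contra! h
    exact absurd (Real.one_lt_rpow h hρ) (not_lt.2 this)

theorem convex_positiveBall {ρ : ℝ} (hρ : 1 ≤ ρ) : Convex ℝ (positiveBall ρ) := by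
  intro w hw z hz α β hα hβ hαβ
  refine ⟨fun j => add_nonneg (mul_nonneg hα (hw.1 j)) (mul_nonneg hβ (hz.1 j)), fun S => ?_⟩
  have h1 : ∀ j, (α • w + β • z) j ^ ρ ≤ α * w j ^ ρ + β * z j ^ ρ := fun j =>
    (convexOn_rpow hρ).2 (hw.1 j) (hz.1 j) hα hβ hαβ
  refine (Finset.sum_le_sum fun j _ => h1 j).trans ?_
  rw [Finset.sum_add_distrib, ← Finset.mul_sum, ← Finset.mul_sum]
  nlinarith [hw.2 S, hz.2 S]

/-- A minimax argument. The sequences |φ(x_j)|^(pt/r) lie in `positiveBall (r / t)`, convex because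
t ≤ r. If no w served all of F, a separating functional would have nonnegative coefficients θ_a; the
concavity estimate for the family θ_a^(1/t) a then contradicts the separation. -/
theorem SupConcave.exists_weight_finset {p q r t D : ℝ} (hD : SupConcave 𝕜 X t D) (hD0 : 0 < D)
    (hp : 0 < p) (hr : 0 < r) (hqt : q.HolderConjugate t) (hrpq : p / r + p / q = 1)
    (htr : t ≤ r) (x : ℕ → X)
    (hx : ∀ φ : StrongDual 𝕜 X, ‖φ‖ ≤ 1 → ∀ S : Finset ℕ, ∑ j ∈ S, ‖φ (x j)‖ ^ p ≤ 1)
    (F : Finset (ℕ → 𝕜)) (S : Finset ℕ) :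
    ∃ w ∈ positiveBall (r / t), ∀ a ∈ F,
      ‖∑ j ∈ S, a j • x j‖ ^ t ≤ D * ∑ j ∈ S, w j * ‖a j‖ ^ t := by
  classical
  have ht := hqt.symm.pos
  by_contra! hcon
  set L : (ℕ → ℝ) →L[ℝ] (F → ℝ) := ContinuousLinearMap.pi fun a =>
    ∑ j ∈ S, (D * ‖a.1 j‖ ^ t) • ContinuousLinearMap.proj j with hL
  have hLapp : ∀ w a, L w a = D * ∑ j ∈ S, w j * ‖a.1 j‖ ^ t := fun w a => by
    simp only [hL, ContinuousLinearMap.coe_pi', sum_apply,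
      smul_apply, ContinuousLinearMap.proj_apply, smul_eq_mul, Finset.mul_sum]
    exact Finset.sum_congr rfl fun j _ => by ring
  set n : F → ℝ := fun a => ‖∑ j ∈ S, a.1 j • x j‖ ^ t with hn
  have hdis : Disjoint (L '' positiveBall (r / t)) (Set.Ici n) := by
    rw [Set.disjoint_left]
    rintro _ ⟨w, hw, rfl⟩ hle
    obtain ⟨a, ha, hlt⟩ := hcon w hw
    have := hle ⟨a, ha⟩
    rw [hLapp] at this
    exact absurd hlt (not_lt.2 this)
  have hρ : 1 ≤ r / t := (one_le_div ht).2 htr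
  obtain ⟨f, u, v, hfu, huv, hfv⟩ := geometric_hahn_banach_compact_closed
    ((convex_positiveBall hρ).linear_image L.toLinearMap)
    ((isCompact_positiveBall (by positivity)).image L.continuous) (convex_Ici n) isClosed_Ici hdis
  set θ : F → ℝ := fun a => f (Pi.single a 1) with hθ
  have hf : ∀ z, f z = ∑ a, z a * θ a := fun z => by
    have := LinearMap.apply_eq_sum_mul_single (𝕜 := ℝ) f.toLinearMap z
    exact this
  have hθ0 : ∀ a, 0 ≤ θ a := fun a => by
    by_contra! h
    have h1 : ∀ k : ℝ, 0 ≤ k → v < f n + k * θ a := fun k hk => by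
      have := hfv (n + k • Pi.single a 1) (by
        refine Set.mem_Ici.2 (le_add_of_nonneg_right ?_)
        exact smul_nonneg hk (Pi.single_nonneg.2 zero_le_one))
      rwa [map_add, map_smul, smul_eq_mul] at this
    have h2 := hfv n (Set.mem_Ici.2 le_rfl)
    have h3 := h1 ((f n - v) / (-θ a)) (div_nonneg (by linarith) (by linarith))
    rw [div_mul_eq_mul_div, div_neg, mul_div_assoc, div_self h.ne] at h3
    linarith
  have hzero : (0 : ℕ → ℝ) ∈ positiveBall (r / t) :=
    ⟨fun _ => le_rfl, fun S => by
      simp only [Pi.zero_apply, Real.zero_rpow (by positivity : r / t ≠ 0),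
        Finset.sum_const_zero, zero_le_one]⟩
  have hu : 0 < u := by simpa using hfu _ ⟨0, hzero, rfl⟩
  have hτ : ∀ (a : F) (j : ℕ), ‖((θ a ^ (1 / t) : ℝ) : 𝕜) * a.1 j‖ ^ t = θ a * ‖a.1 j‖ ^ t :=
    fun a j => by
      have := Real.rpow_nonneg (hθ0 a) (1 / t)
      rw [norm_mul, RCLike.norm_ofReal, abs_of_nonneg this, Real.mul_rpow this (norm_nonneg _),
        ← Real.rpow_mul (hθ0 a), one_div_mul_cancel ht.ne', Real.rpow_one]
  -- The bound U = u / D comes from the separation and cancels the factor D, leaving ∑ θ_a n_a ≤ u.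
  have key := hD.sum_norm_rpow_le hp hqt hrpq (div_pos hu hD0) (fun j : S => x j)
    (fun φ hφ => by rw [Finset.sum_coe_sort S fun j => ‖φ (x j)‖ ^ p]; exact hx φ hφ S)
    (fun (a : F) (j : S) => ((θ a ^ (1 / t) : ℝ) : 𝕜) * a.1 j) (fun φ hφ => by
      have hw : (fun j => ‖φ (x j)‖ ^ (p * t / r)) ∈ positiveBall (r / t) := by
        refine ⟨fun j => by positivity, fun S => le_of_eq_of_le ?_ (hx φ hφ S)⟩
        refine Finset.sum_congr rfl fun j _ => ?_
        rw [← Real.rpow_mul (norm_nonneg _)]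
        congr 1; field_simp
      have h1 := (hfu _ ⟨_, hw, rfl⟩).le
      rw [hf] at h1
      simp only [ContinuousLinearMap.coe_coe, hLapp] at h1
      rw [le_div_iff₀ hD0]
      refine le_of_eq_of_le ?_ h1
      simp only [hτ]
      rw [Finset.sum_coe_sort S
        fun j => (∑ a : F, θ a * ‖a.1 j‖ ^ t) * ‖φ (x j)‖ ^ (p * t / r)]
      simp only [Finset.sum_mul, Finset.mul_sum]
      rw [Finset.sum_comm]
      exact Finset.sum_congr rfl fun a _ => Finset.sum_congr rfl fun j _ => by ring)
  rw [mul_div_cancel₀ _ hD0.ne'] at key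
  have h2 := hfv n (Set.mem_Ici.2 le_rfl)
  rw [hf] at h2
  have h3 : ∀ a : F, ‖∑ j : S, (((θ a ^ (1 / t) : ℝ) : 𝕜) * a.1 j) • x j‖ ^ t = n a * θ a :=
    fun a => by
      have := Real.rpow_nonneg (hθ0 a) (1 / t)
      rw [Finset.sum_coe_sort S fun j => (((θ a ^ (1 / t) : ℝ) : 𝕜) * a.1 j) • x j]
      simp only [mul_smul]
      rw [← Finset.smul_sum, norm_smul, RCLike.norm_ofReal, abs_of_nonneg this,
        Real.mul_rpow this (norm_nonneg _), ← Real.rpow_mul (hθ0 a), one_div_mul_cancel ht.ne',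
        Real.rpow_one, mul_comm]
  simp only [h3] at key
  linarith

/-- Compactness of `positiveBall`: finitely many constraints are reduced to a common index set by
extending the coefficients by zero. -/
theorem SupConcave.exists_weight {p q r t D : ℝ} (hD : SupConcave 𝕜 X t D) (hD0 : 0 < D)
    (hp : 0 < p) (hr : 0 < r) (hqt : q.HolderConjugate t) (hrpq : p / r + p / q = 1)
    (htr : t ≤ r) (x : ℕ → X)
    (hx : ∀ φ : StrongDual 𝕜 X, ‖φ‖ ≤ 1 → ∀ S : Finset ℕ, ∑ j ∈ S, ‖φ (x j)‖ ^ p ≤ 1) :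
    ∃ w ∈ positiveBall (r / t), ∀ (S : Finset ℕ) (a : ℕ → 𝕜),
      ‖∑ j ∈ S, a j • x j‖ ^ t ≤ D * ∑ j ∈ S, w j * ‖a j‖ ^ t := by
  classical
  have ht := hqt.symm.pos
  obtain ⟨w, hw, hwi⟩ := (isCompact_positiveBall (div_pos hr ht)).inter_iInter_nonempty
    (fun P : Finset ℕ × (ℕ → 𝕜) =>
      {w | ‖∑ j ∈ P.1, P.2 j • x j‖ ^ t ≤ D * ∑ j ∈ P.1, w j * ‖P.2 j‖ ^ t})
    (fun P => isClosed_le continuous_const (continuous_const.mul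
      (continuous_finsetSum _ fun j _ => (continuous_apply j).mul continuous_const))) (by
    intro T
    set S := T.biUnion Prod.fst with hS
    set tr : Finset ℕ × (ℕ → 𝕜) → ℕ → 𝕜 := fun P j => if j ∈ P.1 then P.2 j else 0 with htr'
    obtain ⟨w, hw, h⟩ := hD.exists_weight_finset hD0 hp hr hqt hrpq htr x hx (T.image tr) S
    refine ⟨w, hw, Set.mem_iInter₂.2 fun P hP => ?_⟩
    have h1 := h (tr P) (Finset.mem_image_of_mem _ hP)
    have hsub : P.1 ⊆ S := Finset.subset_biUnion_of_mem Prod.fst hP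
    rw [← Finset.sum_subset hsub fun j _ hj => by simp [htr', hj],
      ← Finset.sum_subset hsub fun j _ hj => by simp [htr', hj, Real.zero_rpow ht.ne']] at h1
    have e1 : ∑ j ∈ P.1, tr P j • x j = ∑ j ∈ P.1, P.2 j • x j :=
      Finset.sum_congr rfl fun j hj => by simp [htr', hj]
    have e2 : ∑ j ∈ P.1, w j * ‖tr P j‖ ^ t = ∑ j ∈ P.1, w j * ‖P.2 j‖ ^ t :=
      Finset.sum_congr rfl fun j hj => by simp [htr', hj]
    rwa [e1, e2] at h1)
  exact ⟨w, hw, fun S a => Set.mem_iInter.1 hwi (S, a)⟩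

/-- Duality: the estimate bounds the map a ↦ ∑ a_j y_j on ℓ_t, and testing φ on a_j = |φ(y_j)|^(q-1)
u_j, with u_j cancelling the phase, bounds the ℓ_q norm of (φ(y_j)). -/
theorem weaklySummable_of_norm_sum_le {q t D : ℝ} (hqt : q.HolderConjugate t) (hD : 0 ≤ D)
    {y : ℕ → X}
    (hy : ∀ (S : Finset ℕ) (a : ℕ → 𝕜), ‖∑ j ∈ S, a j • y j‖ ^ t ≤ D * ∑ j ∈ S, ‖a j‖ ^ t) :
    WeaklySummable 𝕜 q y := by
  have hq := hqt.pos
  have ht := hqt.symm.pos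
  rw [weaklySummable_iff hq]
  intro φ
  refine summable_of_sum_le (c := (‖φ‖ * D ^ (1 / t)) ^ q) (fun j => by positivity) fun S => ?_
  choose u hu1 hu2 using fun j => exists_norm_le_one_mul_eq_norm (φ (y j))
  set E := ∑ j ∈ S, ‖φ (y j)‖ ^ q with hE
  have hE0 : 0 ≤ E := by positivity
  rcases hE0.eq_or_lt with h0 | hpos
  · rw [← h0]; positivity
  set a : ℕ → 𝕜 := fun j => ((‖φ (y j)‖ ^ (q - 1) : ℝ) : 𝕜) * u j with ha
  have hat : ∀ j, ‖a j‖ ^ t ≤ ‖φ (y j)‖ ^ q := fun j => by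
    have h1 : ‖a j‖ ≤ ‖φ (y j)‖ ^ (q - 1) := by
      rw [ha, norm_mul, RCLike.norm_ofReal, abs_of_nonneg (by positivity)]
      exact mul_le_of_le_one_right (by positivity) (hu1 j)
    refine (Real.rpow_le_rpow (norm_nonneg _) h1 ht.le).trans (le_of_eq ?_)
    rw [← Real.rpow_mul (norm_nonneg _), hqt.sub_one_mul_conj]
  have h1 : φ (∑ j ∈ S, a j • y j) = (E : 𝕜) := by
    rw [map_sum, hE, RCLike.ofReal_sum]
    refine Finset.sum_congr rfl fun j _ => ?_
    rw [map_smul, smul_eq_mul, ha, mul_assoc, hu2, ← RCLike.ofReal_mul]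
    congr 1
    rcases (norm_nonneg (φ (y j))).eq_or_lt with hz | hz
    · rw [← hz, mul_zero, Real.zero_rpow hq.ne']
    · rw [← Real.rpow_add_one hz.ne', sub_add_cancel]
  have h2 : ‖∑ j ∈ S, a j • y j‖ ≤ D ^ (1 / t) * E ^ (1 / t) := by
    have h3 : ‖∑ j ∈ S, a j • y j‖ ^ t ≤ D * E :=
      (hy S a).trans (mul_le_mul_of_nonneg_left (Finset.sum_le_sum fun j _ => hat j) hD)
    have h4 := Real.rpow_le_rpow (by positivity) h3 (one_div_pos.2 ht).le
    rwa [← Real.rpow_mul (norm_nonneg _), mul_one_div_cancel ht.ne', Real.rpow_one,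
      Real.mul_rpow hD hE0] at h4
  have h5 : E ≤ ‖φ‖ * D ^ (1 / t) * E ^ (1 / t) := by
    calc E = ‖φ (∑ j ∈ S, a j • y j)‖ := by rw [h1, RCLike.norm_ofReal, abs_of_nonneg hE0]
      _ ≤ ‖φ‖ * ‖∑ j ∈ S, a j • y j‖ := φ.le_opNorm _
      _ ≤ ‖φ‖ * (D ^ (1 / t) * E ^ (1 / t)) := mul_le_mul_of_nonneg_left h2 (norm_nonneg _)
      _ = _ := by ring
  have h6 : E ^ (1 / q) ≤ ‖φ‖ * D ^ (1 / t) := by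
    rw [← div_le_iff₀ (by positivity)] at h5
    refine le_of_eq_of_le ?_ h5
    have : 1 / q = 1 - 1 / t := by
      have := hqt.inv_add_inv_eq_one
      rw [one_div, one_div]; linarith
    rw [this, Real.rpow_sub hpos, Real.rpow_one]
  have h7 := Real.rpow_le_rpow (by positivity) h6 hq.le
  rwa [← Real.rpow_mul hE0, one_div_mul_cancel hq.ne', Real.rpow_one] at h7

theorem WeaklySummable.smul_const {p : ℝ} (hp : 0 < p) {x : ℕ → X} (hx : WeaklySummable 𝕜 p x)
    (c : 𝕜) : WeaklySummable 𝕜 p fun j => c • x j := by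
  rw [weaklySummable_iff hp] at hx ⊢
  intro φ
  simp only [map_smul, norm_smul, Real.mul_rpow (norm_nonneg _) (norm_nonneg _)]
  exact (hx φ).mul_left _

/-- In a space of cotype `s` weakly `p`-summable sequences are products of `r`-summable scalar
sequences and weakly `q`-summable sequences, where `1 / r = 1 / p - 1 / q`. -/
theorem WeaklySummable.exists_factorization {s p q : ℝ} (hX : HasCotype X s)
    (h : CotypeRange s p q) (hpq : p < q) {x : ℕ → X} (hx : WeaklySummable 𝕜 p x) :
    ∃ (l : ℕ → ℝ) (y : ℕ → X), (∀ j, 0 ≤ l j) ∧ (Summable fun j => l j ^ (q * p / (q - p))) ∧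
      WeaklySummable 𝕜 q y ∧ ∀ j, x j = (l j : 𝕜) • y j := by
  obtain ⟨D, hD0, hD⟩ := hX.exists_supConcave (𝕜 := 𝕜) h hpq
  have hp1 := h.1
  have hp : 0 < p := by linarith
  have hq1 : 1 < q := by linarith
  have hq : 0 < q := by linarith
  have hd : 0 < q - p := by linarith
  have hqt := Real.HolderConjugate.conjExponent hq1
  set t := q.conjExponent with ht
  have ht0 : 0 < t := hqt.symm.pos
  set r := q * p / (q - p) with hr
  have hr0 : 0 < r := by positivity
  have hrpq : p / r + p / q = 1 := by rw [hr]; field_simp; ring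
  -- Equivalent to q ≤ pq; this is where p ≥ 1 enters.
  have htr : t ≤ r := by
    rw [ht, hr, Real.conjExponent, div_le_div_iff₀ (by linarith) hd]
    nlinarith [mul_nonneg hq.le (mul_nonneg hq.le (sub_nonneg.2 hp1))]
  obtain ⟨M, hM, hMx⟩ := hx.exists_sum_le hp
  set μ : ℝ := M ^ (1 / p) with hμ
  have hμ0 : 0 < μ := by positivity
  have hμp : μ ^ p = M := by
    rw [hμ, ← Real.rpow_mul hM.le, one_div_mul_cancel hp.ne', Real.rpow_one]
  have hμk : (μ : 𝕜) ≠ 0 := by exact_mod_cast hμ0.ne'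
  set x' : ℕ → X := fun j => (μ : 𝕜)⁻¹ • x j with hx'
  have hx'1 : ∀ φ : StrongDual 𝕜 X, ‖φ‖ ≤ 1 → ∀ S : Finset ℕ, ∑ j ∈ S, ‖φ (x' j)‖ ^ p ≤ 1 :=
    fun φ hφ S => by
      have : ∀ j, ‖φ (x' j)‖ ^ p = ‖φ (x j)‖ ^ p / M := fun j => by
        rw [hx', map_smul, norm_smul, norm_inv, RCLike.norm_ofReal, abs_of_pos hμ0,
          Real.mul_rpow (by positivity) (norm_nonneg _), Real.inv_rpow hμ0.le, hμp, inv_mul_eq_div]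
      simp only [this]
      rw [← Finset.sum_div, div_le_one hM]
      exact hMx φ hφ S
  obtain ⟨w, hw, hwx⟩ := hD.exists_weight hD0 hp hr0 hqt hrpq htr x' hx'1
  set l : ℕ → ℝ := fun j => w j ^ (1 / t) with hl
  have hl0 : ∀ j, 0 ≤ l j := fun j => Real.rpow_nonneg (hw.1 j) _
  have hlt : ∀ j, l j ^ t = w j := fun j => by
    rw [hl, ← Real.rpow_mul (hw.1 j), one_div_mul_cancel ht0.ne', Real.rpow_one]
  set y : ℕ → X := fun j => (l j : 𝕜)⁻¹ • x' j with hy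
  have hyW : WeaklySummable 𝕜 q y := by
    refine weaklySummable_of_norm_sum_le hqt hD0.le fun S a => ?_
    have h1 := hwx S fun j => a j * (l j : 𝕜)⁻¹
    simp only [mul_smul] at h1
    refine h1.trans (mul_le_mul_of_nonneg_left (Finset.sum_le_sum fun j _ => ?_) hD0.le)
    rw [norm_mul, norm_inv, RCLike.norm_ofReal, abs_of_nonneg (hl0 j),
      Real.mul_rpow (norm_nonneg _) (inv_nonneg.2 (hl0 j)), Real.inv_rpow (hl0 j), hlt]
    calc w j * (‖a j‖ ^ t * (w j)⁻¹) = ‖a j‖ ^ t * (w j / w j) := by ring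
      _ ≤ ‖a j‖ ^ t := mul_le_of_le_one_right (by positivity) (div_self_le_one _)
  have hxy : ∀ j, x' j = (l j : 𝕜) • y j := fun j => by
    -- When l_j = 0, the weighted estimate on {j} forces x'_j = 0.
    rcases eq_or_ne (l j) 0 with hj | hj
    · have h1 := hwx {j} fun _ => 1
      have hwj : w j = 0 := by rw [← hlt, hj, Real.zero_rpow ht0.ne']
      simp only [Finset.sum_singleton, one_smul, hwj, zero_mul, mul_zero] at h1
      have h2 := (Real.rpow_eq_zero (norm_nonneg _) ht0.ne').1
        (le_antisymm h1 (Real.rpow_nonneg (norm_nonneg _) _))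
      rw [norm_eq_zero.1 h2, hj]; simp
    · rw [hy, smul_inv_smul₀]
      exact_mod_cast hj
  refine ⟨l, fun j => (μ : 𝕜) • y j, hl0, ?_, hyW.smul_const hq _, fun j => ?_⟩
  · refine summable_of_sum_le (c := 1) (fun j => Real.rpow_nonneg (hl0 j) _) fun S => ?_
    refine le_of_eq_of_le (Finset.sum_congr rfl fun j _ => ?_) (hw.2 S)
    rw [hl, ← Real.rpow_mul (hw.1 j)]
    congr 1; ring
  · rw [smul_comm, ← hxy, hx', smul_inv_smul₀ hμk]

end Factorization

/-! ### Abel-Dini theorem, Hölder's inequality and its converse. -/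

section AbelDini

/-- If the quotients were summable, some tail from N on would be at most 1/2, giving (P_M - P_N) /
(1 + P_M) ≤ 1/2 and hence bounded partial sums P_M ≤ 1 + 2 P_N. -/
theorem not_summable_div_one_add_sum {c : ℕ → ℝ} (hc : ∀ j, 0 ≤ c j) (h : ¬Summable c) :
    ¬Summable fun j => c j / (1 + ∑ i ∈ Finset.range (j + 1), c i) := by
  intro hs
  refine h ?_
  have hg0 : ∀ j, 0 ≤ c j / (1 + ∑ i ∈ Finset.range (j + 1), c i) := fun j =>
    div_nonneg (hc j) (add_nonneg zero_le_one (Finset.sum_nonneg fun i _ => hc i))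
  have hlt := hs.hasSum.tendsto_sum_nat
  set τ := ∑' j, c j / (1 + ∑ i ∈ Finset.range (j + 1), c i)
  obtain ⟨N, hN⟩ := (hlt.eventually (lt_mem_nhds (show τ - 1 / 2 < τ by linarith))).exists
  have hmono : ∀ {a b : ℕ}, a ≤ b → ∑ i ∈ Finset.range a, c i ≤ ∑ i ∈ Finset.range b, c i :=
    fun hab => Finset.sum_le_sum_of_subset_of_nonneg (Finset.range_mono hab) fun i _ _ => hc i
  have hsum0 : ∀ n, 0 ≤ ∑ i ∈ Finset.range n, c i := fun n => Finset.sum_nonneg fun i _ => hc i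
  refine summable_of_sum_range_le (c := 1 + 2 * ∑ i ∈ Finset.range N, c i) hc fun M => ?_
  rcases le_total M N with hMN | hNM
  · linarith [hmono hMN, hsum0 N]
  have h1 := hs.sum_le_tsum (Finset.range M) fun j _ => hg0 j
  have h2 := Finset.sum_range_add_sum_Ico
    (fun j => c j / (1 + ∑ i ∈ Finset.range (j + 1), c i)) hNM
  have h3 := Finset.sum_range_add_sum_Ico c hNM
  have hP : 0 < 1 + ∑ i ∈ Finset.range M, c i := by linarith [hsum0 M]
  have h4 : (∑ j ∈ Finset.Ico N M, c j) / (1 + ∑ i ∈ Finset.range M, c i) ≤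
      ∑ j ∈ Finset.Ico N M, c j / (1 + ∑ i ∈ Finset.range (j + 1), c i) := by
    rw [Finset.sum_div]
    refine Finset.sum_le_sum fun j hj => ?_
    refine div_le_div_of_nonneg_left (hc j) (by linarith [hsum0 (j + 1)]) ?_
    linarith [hmono (Nat.succ_le_of_lt (Finset.mem_Ico.1 hj).2)]
  have h5 : (∑ j ∈ Finset.Ico N M, c j) / (1 + ∑ i ∈ Finset.range M, c i) ≤ 1 / 2 := by
    change _ ≤ τ at h1
    linarith
  rw [div_le_iff₀ hP] at h5
  linarith

/-- Each term is at most (x^(-ε) - y^(-ε)) / ε for consecutive values x, y of 1 plus the partial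
sums, so the series telescopes. -/
theorem summable_div_one_add_sum_rpow {c : ℕ → ℝ} (hc : ∀ j, 0 ≤ c j) {ε : ℝ} (hε : 0 < ε) :
    Summable fun j => c j / (1 + ∑ i ∈ Finset.range (j + 1), c i) ^ (1 + ε) := by
  have hsum0 : ∀ n, 0 ≤ ∑ i ∈ Finset.range n, c i := fun n => Finset.sum_nonneg fun i _ => hc i
  have hP : ∀ n, 0 < 1 + ∑ i ∈ Finset.range n, c i := fun n => by linarith [hsum0 n]
  refine summable_of_sum_range_le (c := 1 / ε)
    (fun j => div_nonneg (hc j) (Real.rpow_nonneg (hP _).le _)) fun n => ?_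
  suffices h : ∑ j ∈ Finset.range n, c j / (1 + ∑ i ∈ Finset.range (j + 1), c i) ^ (1 + ε) ≤
      (1 - (1 + ∑ i ∈ Finset.range n, c i) ^ (-ε)) / ε by
    refine h.trans ?_
    have := Real.rpow_nonneg (hP n).le (-ε)
    gcongr
    linarith
  induction n with
  | zero => simp
  | succ n ih =>
    rw [Finset.sum_range_succ]
    have e : 1 + ∑ i ∈ Finset.range (n + 1), c i = 1 + ∑ i ∈ Finset.range n, c i + c n := by
      rw [Finset.sum_range_succ]; ring
    set x := 1 + ∑ i ∈ Finset.range n, c i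
    set y := 1 + ∑ i ∈ Finset.range (n + 1), c i
    have hx : 0 < x := hP n
    have hy : 0 < y := hP (n + 1)
    have h1 : 1 + ε * (1 - x / y) ≤ (x / y) ^ (-ε) := by
      rw [Real.rpow_def_of_pos (by positivity)]
      have h2 := Real.add_one_le_exp (Real.log (x / y) * -ε)
      have h3 := Real.log_le_sub_one_of_pos (show 0 < x / y by positivity)
      nlinarith
    rw [Real.div_rpow hx.le hy.le, le_div_iff₀ (by positivity)] at h1
    have h4 : c n / y ^ (1 + ε) = (1 - x / y) * y ^ (-ε) := by
      rw [show c n = y - x by linarith, Real.rpow_add hy, Real.rpow_one, Real.rpow_neg hy.le]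
      field_simp
    rw [h4]
    have h5 : (1 - x ^ (-ε)) / ε + (1 - x / y) * y ^ (-ε) ≤ (1 - y ^ (-ε)) / ε := by
      rw [← sub_nonneg]
      have : (1 - y ^ (-ε)) / ε - ((1 - x ^ (-ε)) / ε + (1 - x / y) * y ^ (-ε)) =
          (x ^ (-ε) - (1 + ε * (1 - x / y)) * y ^ (-ε)) / ε := by
        field_simp; ring
      rw [this]
      exact div_nonneg (by linarith) hε.le
    linarith

/-- The converse of Hölder's inequality for sequences: multipliers from `ℓ_ρ` to `ℓ_α` belong to
`ℓ_q`, where `1 / α = 1 / ρ + 1 / q`. -/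
theorem summable_rpow_of_forall_mul {ρ q α : ℝ} (hρ : 0 < ρ) (hq : 0 < q) (hα : 0 < α)
    (h : α / ρ + α / q = 1) {a : ℕ → ℝ} (ha : ∀ j, 0 ≤ a j)
    (H : ∀ l : ℕ → ℝ, (∀ j, 0 ≤ l j) → (Summable fun j => l j ^ ρ) →
      Summable fun j => (l j * a j) ^ α) : Summable fun j => a j ^ q := by
  by_contra hns
  set c : ℕ → ℝ := fun j => a j ^ q with hc
  have hc0 : ∀ j, 0 ≤ c j := fun j => Real.rpow_nonneg (ha j) _
  set S : ℕ → ℝ := fun j => 1 + ∑ i ∈ Finset.range (j + 1), c i with hS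
  have hS0 : ∀ j, 0 < S j := fun j =>
    add_pos_of_pos_of_nonneg zero_lt_one (Finset.sum_nonneg fun i _ => hc0 i)
  have hε : 0 < ρ / α - 1 := by
    have h1 : 0 < α / q := by positivity
    rw [sub_pos, one_lt_div hα, ← div_lt_one hρ]
    linarith
  refine not_summable_div_one_add_sum hc0 hns ?_
  have hl0 : ∀ j, 0 ≤ c j / S j ^ (ρ / α) := fun j =>
    div_nonneg (hc0 j) (Real.rpow_nonneg (hS0 j).le _)
  -- Here l^ρ = c / S^(ρ/α) is summable since ρ/α > 1, while (l a)^α = c / S is not, by Abel-Dini.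
  have key := H (fun j => (c j / S j ^ (ρ / α)) ^ (1 / ρ)) (fun j => Real.rpow_nonneg (hl0 j) _) (by
    have := summable_div_one_add_sum_rpow hc0 hε
    rw [add_sub_cancel] at this
    refine this.congr fun j => ?_
    rw [← Real.rpow_mul (hl0 j), one_div_mul_cancel hρ.ne', Real.rpow_one])
  refine key.congr fun j => ?_
  have e1 : a j = c j ^ (1 / q) := by
    rw [hc, ← Real.rpow_mul (ha j), mul_one_div_cancel hq.ne', Real.rpow_one]
  rw [e1, Real.mul_rpow (Real.rpow_nonneg (hl0 j) _) (Real.rpow_nonneg (hc0 j) _),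
    ← Real.rpow_mul (hl0 j), ← Real.rpow_mul (hc0 j),
    Real.div_rpow (hc0 j) (Real.rpow_nonneg (hS0 j).le _), ← Real.rpow_mul (hS0 j).le,
    div_mul_eq_mul_div, ← Real.rpow_add' (hc0 j)]
  · have e2 : 1 / ρ * α + 1 / q * α = 1 := by linear_combination h
    have e3 : ρ / α * (1 / ρ * α) = 1 := by field_simp
    rw [e2, e3, Real.rpow_one, Real.rpow_one]
  · have : 1 / ρ * α + 1 / q * α = 1 := by linear_combination h
    rw [this]; norm_num

/-- Hölder's inequality for sequences, qualitative form. -/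
theorem summable_mul_rpow {ρ q α : ℝ} (hρ : 0 < ρ) (hq : 0 < q) (hα : 0 < α)
    (h : α / ρ + α / q = 1) {l a : ℕ → ℝ} (hl : ∀ j, 0 ≤ l j) (ha : ∀ j, 0 ≤ a j)
    (hls : Summable fun j => l j ^ ρ) (has : Summable fun j => a j ^ q) :
    Summable fun j => (l j * a j) ^ α := by
  refine Summable.of_nonneg_of_le (fun j => Real.rpow_nonneg (mul_nonneg (hl j) (ha j)) _)
    (fun j => ?_) ((hls.mul_left (α / ρ)).add (has.mul_left (α / q)))
  have := Real.geom_mean_le_arith_mean2_weighted (by positivity) (by positivity)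
    (Real.rpow_nonneg (hl j) ρ) (Real.rpow_nonneg (ha j) q) h
  rwa [← Real.rpow_mul (hl j), ← Real.rpow_mul (ha j), mul_div_cancel₀ _ hρ.ne',
    mul_div_cancel₀ _ hq.ne', ← Real.mul_rpow (hl j) (ha j)] at this

theorem summable_prod_rpow {n : ℕ} (hn : 0 < n) {r : ℝ} {l : Fin n → ℕ → ℝ}
    (hl : ∀ k j, 0 ≤ l k j) (hls : ∀ k, Summable fun j => l k j ^ r) :
    Summable fun j => (∏ k, l k j) ^ (r / n) := by
  have hn' : (0 : ℝ) < n := by exact_mod_cast hn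
  refine Summable.of_nonneg_of_le
    (fun j => Real.rpow_nonneg (Finset.prod_nonneg fun k _ => hl k j) _)
    (fun j => ?_) (summable_sum (s := Finset.univ) fun k _ => (hls k).mul_left (1 / n : ℝ))
  have := Real.geom_mean_le_arith_mean_weighted Finset.univ (fun _ : Fin n => (1 / n : ℝ))
    (fun k => l k j ^ r) (fun _ _ => by positivity) (by simp [hn'.ne'])
    fun k _ => Real.rpow_nonneg (hl k j) _
  refine le_of_eq_of_le ?_ this
  rw [← Real.finsetProd_rpow _ _ fun k _ => hl k j]
  refine Finset.prod_congr rfl fun k _ => ?_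
  rw [← Real.rpow_mul (hl k j)]
  congr 1; ring

end AbelDini

/-! ### The two inclusions and the main theorem. -/

section Inclusions

variable {𝕜 : Type w} [RCLike 𝕜] {n : ℕ} {X : Fin n → Type u} [∀ i, NormedAddCommGroup (X i)]
  [∀ i, NormedSpace 𝕜 (X i)] {Y : Type v} [NormedAddCommGroup Y] [NormedSpace 𝕜 Y]

theorem mem_absolutelySumming_iff {p : ℝ} (hp : 0 < p) {q : Fin n → ℝ}
    {T : ContinuousMultilinearMap 𝕜 X Y} :
    T ∈ absolutelySumming 𝕜 X Y p q ↔ ∀ x : (i : Fin n) → ℕ → X i,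
      (∀ i, WeaklySummable 𝕜 (q i) (x i)) → Summable fun j => ‖T fun i => x i j‖ ^ p := by
  unfold absolutelySumming
  refine forall_congr' fun x => forall_congr' fun _ => ?_
  rw [memℓp_gen_iff (by rwa [ENNReal.toReal_ofReal hp.le]), ENNReal.toReal_ofReal hp.le]

theorem summingExponent_pos {p q : ℝ} (hp : 0 < p) (hpq : p ≤ q) :
    0 < q * p / (n * (q - p) + p) := by
  have : 0 ≤ (n : ℝ) * (q - p) := mul_nonneg n.cast_nonneg (by linarith)
  have : 0 < q := hp.trans_le hpq
  positivity

theorem summingExponent_holder {p q : ℝ} (hn : 0 < n) (hp : 0 < p) (hpq : p < q) :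
    q * p / (n * (q - p) + p) / (q * p / (q - p) / n) + q * p / (n * (q - p) + p) / q = 1 := by
  have hn' : (0 : ℝ) < n := by exact_mod_cast hn
  have : 0 < q - p := by linarith
  have : 0 < (n : ℝ) * (q - p) + p := by positivity
  have : 0 < q := hp.trans hpq
  field_simp

theorem absolutelySumming_subset_of_hasCotype {s p q : ℝ} (hn : 0 < n) (h : CotypeRange s p q)
    (hpq : p < q) (hX : ∀ i, HasCotype (X i) s) :
    absolutelySumming 𝕜 X Y q (fun _ => q) ⊆
      absolutelySumming 𝕜 X Y (q * p / (n * (q - p) + p)) (fun _ => p) := by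
  have hp : 0 < p := by linarith [h.1]
  have hq : 0 < q := hp.trans hpq
  have hn' : (0 : ℝ) < n := by exact_mod_cast hn
  have hd : 0 < q - p := by linarith
  have hα := summingExponent_pos (n := n) hp hpq.le
  intro T hT
  rw [mem_absolutelySumming_iff hq] at hT
  rw [mem_absolutelySumming_iff hα]
  intro x hx
  choose l y hl0 hls hy hxy using fun i => (hx i).exists_factorization (hX i) h hpq
  refine (summable_mul_rpow (by positivity) hq hα (summingExponent_holder hn hp hpq)
    (fun j => Finset.prod_nonneg fun k _ => hl0 k j) (fun j => norm_nonneg _)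
    (summable_prod_rpow hn hl0 hls) (hT y hy)).congr fun j => ?_
  have : (fun i => x i j) = fun i => (l i j : 𝕜) • y i j := funext fun i => hxy i j
  rw [this, T.map_smul_univ, norm_smul, norm_prod]
  congr 2
  exact Finset.prod_congr rfl fun k _ => by rw [RCLike.norm_ofReal, abs_of_nonneg (hl0 k j)]

theorem absolutelySumming_subset_of_lt {p q : ℝ} (hn : 0 < n) (hp : 0 < p) (hpq : p < q) :
    absolutelySumming 𝕜 X Y (q * p / (n * (q - p) + p)) (fun _ => p) ⊆
      absolutelySumming 𝕜 X Y q (fun _ => q) := by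
  have hq : 0 < q := hp.trans hpq
  have hn' : (0 : ℝ) < n := by exact_mod_cast hn
  have hd : 0 < q - p := by linarith
  have hα := summingExponent_pos (n := n) hp hpq.le
  intro T hT
  rw [mem_absolutelySumming_iff hα] at hT
  rw [mem_absolutelySumming_iff hq]
  intro x hx
  refine summable_rpow_of_forall_mul (ρ := q * p / (q - p) / n) (by positivity) hq hα
    (summingExponent_holder hn hp hpq) (fun j => norm_nonneg _) fun l hl0 hls => ?_
  -- The multiplier l in ℓ_{r/n} is shared equally among the n arguments: m is in ℓ_r, so m x is
  -- weakly p-summable, and m^n = l comes out of T.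
  set m : ℕ → ℝ := fun j => l j ^ (1 / n : ℝ) with hm
  have hm0 : ∀ j, 0 ≤ m j := fun j => Real.rpow_nonneg (hl0 j) _
  have hms : Summable fun j => m j ^ (q * p / (q - p)) := hls.congr fun j => by
    rw [hm, ← Real.rpow_mul (hl0 j)]
    congr 1; ring
  refine (hT (fun i j => (m j : 𝕜) • x i j) fun i => ?_).congr fun j => ?_
  · rw [weaklySummable_iff hp]
    intro φ
    refine (summable_mul_rpow (ρ := q * p / (q - p)) (by positivity) hq hp
      (by field_simp; ring) hm0 (fun j => norm_nonneg (φ (x i j))) hms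
      ((weaklySummable_iff hq).1 (hx i) φ)).congr fun j => ?_
    rw [map_smul, norm_smul, RCLike.norm_ofReal, abs_of_nonneg (hm0 j)]
  · rw [T.map_smul_univ, norm_smul, norm_prod]
    congr 2
    simp only [RCLike.norm_ofReal, abs_of_nonneg (hm0 j), Finset.prod_const, Finset.card_univ,
      Fintype.card_fin]
    rw [hm, ← Real.rpow_mul_natCast (hl0 j), one_div_mul_cancel hn'.ne', Real.rpow_one]

theorem absolutelySumming_eq_of_hasCotype {s p q : ℝ} (hn : 0 < n) (h : CotypeRange s p q)
    (hX : ∀ i, HasCotype (X i) s) :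
    absolutelySumming 𝕜 X Y q (fun _ => q) =
      absolutelySumming 𝕜 X Y (q * p / (n * (q - p) + p)) (fun _ => p) := by
  have hp : 0 < p := by linarith [h.1]
  rcases h.2.1.eq_or_lt with rfl | hpq
  · have : p * p / (n * (p - p) + p) = p := by field_simp; simp
    rw [this]
  · exact (absolutelySumming_subset_of_hasCotype hn h hpq hX).antisymm
      (absolutelySumming_subset_of_lt hn hp hpq)

end Inclusions

theorem mainTheorem2 {𝕜 : Type w} [RCLike 𝕜] (n : ℕ) (hn : 2 ≤ n) (s p q : ℝ)
    (hspq : CotypeRange s p q) :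
    (∀ (X : Fin n → Type u) [∀ i, NormedAddCommGroup (X i)] [∀ i, NormedSpace 𝕜 (X i)]
        [∀ i, CompleteSpace (X i)], (∀ i, HasCotype (X i) s) →
      ∀ (Y : Type v) [NormedAddCommGroup Y] [NormedSpace 𝕜 Y] [CompleteSpace Y],
        absolutelySumming 𝕜 X Y q (fun _ => q) =
          absolutelySumming 𝕜 X Y (q * p / (n * (q - p) + p)) (fun _ => p)) ∧
    q * p / (n * (q - p) + p) ∈ inclusionExponents.{u, v, w} 𝕜 n p q ∧
    optimalExponent.{u, v, w} 𝕜 n p q ≤ q * p / (n * (q - p) + p) := by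
  have hn0 : 0 < n := by omega
  have hp : 0 < p := by linarith [hspq.1]
  have hpq : p ≤ q := hspq.2.1
  have hq : 0 < q := hp.trans_le hpq
  have hmem : q * p / (n * (q - p) + p) ∈ inclusionExponents.{u, v, w} 𝕜 n p q := by
    refine ⟨summingExponent_pos hp hpq, ?_, fun s' hs' X _ _ _ hX Y _ _ _ =>
      (absolutelySumming_eq_of_hasCotype hn0 hs' hX).subset⟩
    -- The admissibility condition 1/α ≤ n/p reduces to p^2 ≤ n p^2.
    rw [one_div_div, Finset.sum_const, Finset.card_univ, Fintype.card_fin, nsmul_eq_mul,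
      mul_one_div, div_le_div_iff₀ (by positivity) hp]
    have h1 : (1 : ℝ) ≤ n := by exact_mod_cast hn0
    nlinarith [mul_nonneg (mul_nonneg hp.le hp.le) (sub_nonneg.2 h1)]
  exact ⟨fun X _ _ _ hX Y _ _ _ => absolutelySumming_eq_of_hasCotype hn0 hspq hX, hmem,
    csInf_le ⟨0, fun α hα => hα.1.le⟩ hmem⟩
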